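/- Let $k\ge 1$ be an integer and let $a\in C^\infty(\mathbf R)$ be real valued. In $\mathbf R^3=\{(x,y,t)\}$ put $X=\partial_x$, $Y=\partial_y+x^k\partial_t$ and $$L=-X^2-Y^2+i\,a(x)[X,Y].$$ Say that $L$ is locally solvable at $0$ if there is an open neighbourhood $V$ of $0$ such that for every $f\in C_0^\infty(V)$ there is a distribution $u\in\mathcal D'(V)$ with $Lu=f$ in $V$. Say that $L$ is locally solvable in $L^2$ at $0$ if for every $f\in L^2(\mathbf R^3)$ there are an open neighbourhood $V$ of $0$ and a locally square integrable function $u$ on $V$ such that $Lu=f$ in $V$ in the sense of distributions. (1) Suppose that either $k=1$ and $a(0)\in\{\pm1,\pm3,\pm5,\dots\}$, or $k>1$ is odd and $a(0)\in\{\pm1\}$. If $a'(0)=a''(0)=0$, then $L$ is not locally solvable in $L^2$ at $0$. (2) Some of the locally solvable operators of this family lose derivatives: there exist $k\ge1$ and a real valued $a\in C^\infty(\mathbf R)$ such that $L$ is locally solvable at $0$ but is not locally solvable in $L^2$ at $0$. -/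

import Mathlib

open MeasureTheory TopologicalSpace
open scoped ContDiff Distributions

noncomputable section

namespace DoubleChar

/-- Points `(x, y, t)` of `ℝ³`. -/
abbrev R3 : Type := ℝ × ℝ × ℝ

/-- The vector field `X = ∂_x`. -/
def X (u : R3 → ℂ) : R3 → ℂ := fun p => fderiv ℝ u p (1, 0, 0)

/-- The vector field `Y = ∂_y + x ^ k ∂_t`. -/
def Y (k : ℕ) (u : R3 → ℂ) : R3 → ℂ := fun p => fderiv ℝ u p (0, 1, p.1 ^ k)

/-- The commutator `[X, Y] = X Y - Y X`. -/
def XY (k : ℕ) (u : R3 → ℂ) : R3 → ℂ := fun p => X (Y k u) p - Y k (X u) p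

/-- The operator `L = -X² - Y² + i a(x) [X, Y]`, acting on smooth functions. -/
def L (k : ℕ) (a : ℝ → ℝ) (u : R3 → ℂ) : R3 → ℂ := fun p =>
  -X (X u) p - Y k (Y k u) p + Complex.I * (a p.1 : ℂ) * XY k u p

/-- The transpose of `L` with respect to the bilinear pairing `∫ u v`; it is obtained from `L`
by replacing `a` by `-a`, see `integral_L_mul`. -/
def Lt (k : ℕ) (a : ℝ → ℝ) (u : R3 → ℂ) : R3 → ℂ := L k (fun x => -a x) u

section Regularity

variable {u v : R3 → ℂ} {k : ℕ} {a : ℝ → ℝ}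

lemma contDiff_X (hu : ContDiff ℝ ∞ u) : ContDiff ℝ ∞ (X u) := by
  have h : ContDiff ℝ ∞ (fderiv ℝ u) := hu.fderiv_right (by simp)
  exact h.clm_apply contDiff_const

lemma contDiff_Y (hu : ContDiff ℝ ∞ u) : ContDiff ℝ ∞ (Y k u) := by
  have h : ContDiff ℝ ∞ (fderiv ℝ u) := hu.fderiv_right (by simp)
  exact h.clm_apply (contDiff_const.prodMk (contDiff_const.prodMk (contDiff_fst.pow k)))

lemma contDiff_coeff (ha : ContDiff ℝ ∞ a) :
    ContDiff ℝ ∞ (fun p : R3 => Complex.I * (a p.1 : ℂ)) :=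
  contDiff_const.mul (Complex.ofRealCLM.contDiff.comp (ha.comp contDiff_fst))

lemma contDiff_L (ha : ContDiff ℝ ∞ a) (hu : ContDiff ℝ ∞ u) : ContDiff ℝ ∞ (L k a u) :=
  ((contDiff_X (contDiff_X hu)).neg.sub (contDiff_Y (contDiff_Y hu))).add
    ((contDiff_coeff ha).mul
      ((contDiff_X (contDiff_Y hu)).sub (contDiff_Y (contDiff_X hu))))

lemma tsupport_X_subset : tsupport (X u) ⊆ tsupport u :=
  (closure_mono fun p hp => by
    contrapose! hp
    simp [X, Function.notMem_support.1 hp]).trans (tsupport_fderiv_subset ℝ (f := u))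

lemma tsupport_Y_subset : tsupport (Y k u) ⊆ tsupport u :=
  (closure_mono fun p hp => by
    contrapose! hp
    simp [Y, Function.notMem_support.1 hp]).trans (tsupport_fderiv_subset ℝ (f := u))

lemma tsupport_L_subset : tsupport (L k a u) ⊆ tsupport u := by
  refine closure_minimal (fun p hp => ?_) (isClosed_tsupport u)
  by_contra h
  have hX : ∀ {w : R3 → ℂ}, p ∉ tsupport w → X w p = 0 := fun hw =>
    image_eq_zero_of_notMem_tsupport fun h' => hw (tsupport_X_subset h')
  have hY : ∀ {w : R3 → ℂ}, p ∉ tsupport w → Y k w p = 0 := fun hw =>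
    image_eq_zero_of_notMem_tsupport fun h' => hw (tsupport_Y_subset h')
  have h1 : p ∉ tsupport (X u) := fun h' => h (tsupport_X_subset h')
  have h2 : p ∉ tsupport (Y k u) := fun h' => h (tsupport_Y_subset h')
  exact hp (by simp [L, XY, hX h1, hX h2, hY h1, hY h2])

end Regularity

/-- The transpose of `L` as a map from `C₀^∞(V)` to itself. -/
def LtTest (k : ℕ) (a : ℝ → ℝ) (ha : ContDiff ℝ ∞ a) {V : Opens R3} (ψ : 𝓓(V, ℂ)) : 𝓓(V, ℂ) where
  toFun := Lt k a ψ
  contDiff' := contDiff_L ha.neg ψ.contDiff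
  hasCompactSupport' :=
    ψ.hasCompactSupport.of_isClosed_subset (isClosed_tsupport _) tsupport_L_subset
  tsupport_subset' := tsupport_L_subset.trans ψ.tsupport_subset

/-- Local solvability at the origin: there is an open neighbourhood `V` of `0` such that for every
`f ∈ C₀^∞(V)` there is a distribution `u ∈ 𝓓'(V)` (a continuous linear form on `C₀^∞(V)`) with
`L u = f` in `V`. -/
def LocallySolvable (k : ℕ) (a : ℝ → ℝ) (ha : ContDiff ℝ ∞ a) : Prop :=
  ∃ V : Opens R3, (0 : R3) ∈ V ∧ ∀ f : 𝓓(V, ℂ), ∃ u : 𝓓(V, ℂ) →L[ℂ] ℂ,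
    ∀ ψ : 𝓓(V, ℂ), u (LtTest k a ha ψ) = ∫ p, f p * ψ p

/-- `u` is locally square integrable on the open set `V`. -/
def LocL2 (V : Opens R3) (u : R3 → ℂ) : Prop :=
  ∀ K : Set R3, IsCompact K → K ⊆ V → MemLp u 2 (volume.restrict K)

/-- Local solvability in `L²` at the origin: for every `f ∈ L²` there is a locally square
integrable `u` with `L u = f`, in the sense of distributions, in a neighbourhood of `0`
(which may depend on `f`). -/
def LocallySolvableL2 (k : ℕ) (a : ℝ → ℝ) : Prop :=
  ∀ f : R3 → ℂ, MemLp f 2 volume →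
    ∃ V : Opens R3, (0 : R3) ∈ V ∧ ∃ u : R3 → ℂ, LocL2 V u ∧
      ∀ ψ : 𝓓(V, ℂ), ∫ p, u p * Lt k a ψ p = ∫ p, f p * ψ p

section Transpose

variable {u v : R3 → ℂ} {k : ℕ} {a : ℝ → ℝ}

lemma X_mul (hu : Differentiable ℝ u) (hv : Differentiable ℝ v) :
    X (fun p => u p * v p) = fun p => u p * X v p + X u p * v p := by
  funext p
  simp only [X, fderiv_fun_mul (hu p) (hv p)]
  simp [mul_comm]

lemma Y_mul (hu : Differentiable ℝ u) (hv : Differentiable ℝ v) :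
    Y k (fun p => u p * v p) = fun p => u p * Y k v p + Y k u p * v p := by
  funext p
  simp only [Y, fderiv_fun_mul (hu p) (hv p)]
  simp [mul_comm]

lemma integrable_of_supp (hu : Continuous u) (hc : HasCompactSupport u) : Integrable u :=
  hu.integrable_of_hasCompactSupport hc

lemma hasCompactSupport_X (hc : HasCompactSupport u) : HasCompactSupport (X u) :=
  hc.of_isClosed_subset (isClosed_tsupport _) tsupport_X_subset

lemma hasCompactSupport_Y (hc : HasCompactSupport u) : HasCompactSupport (Y k u) :=
  hc.of_isClosed_subset (isClosed_tsupport _) tsupport_Y_subset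

lemma integral_fderiv_const_mul (j : ℕ) (hu : ContDiff ℝ ∞ u) (hc : HasCompactSupport u) (w : R3)
    (hw : j = 0 ∨ w.1 = 0) : ∫ p : R3, ((p.1 ^ j : ℝ) : ℂ) * fderiv ℝ u p w = 0 := by
  have hg : ContDiff ℝ ∞ (fun p : R3 => ((p.1 ^ j : ℝ) : ℂ)) :=
    Complex.ofRealCLM.contDiff.comp (contDiff_fst.pow j)
  have hg0 : ∀ p : R3, fderiv ℝ (fun p : R3 => ((p.1 ^ j : ℝ) : ℂ)) p w = 0 := by
    intro p
    rcases hw with rfl | hw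
    · simp
    · have h1 : HasFDerivAt (fun p : R3 => p.1 ^ j)
          ((j * p.1 ^ (j - 1)) • ContinuousLinearMap.fst ℝ ℝ (ℝ × ℝ)) p := by
        have := (hasDerivAt_pow j p.1).comp_hasFDerivAt p
          (ContinuousLinearMap.fst ℝ ℝ (ℝ × ℝ)).hasFDerivAt
        exact this
      have h2 := (Complex.ofRealCLM.hasFDerivAt (x := p.1 ^ j)).comp p h1
      have h3 : HasFDerivAt (fun p : R3 => ((p.1 ^ j : ℝ) : ℂ)) _ p := h2
      rw [h3.fderiv]
      simp [hw]
  have hfc : Continuous (fun p => fderiv ℝ u p w) :=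
    (hu.continuous_fderiv (by simp)).clm_apply continuous_const
  have hfs : HasCompactSupport (fun p => fderiv ℝ u p w) := hc.fderiv_apply ℝ w
  have : (volume : Measure (ℝ × ℝ)).IsAddHaarMeasure :=
    inferInstanceAs ((volume : Measure ℝ).prod (volume : Measure ℝ)).IsAddHaarMeasure
  have : (volume : Measure R3).IsAddHaarMeasure :=
    inferInstanceAs ((volume : Measure ℝ).prod (volume : Measure (ℝ × ℝ))).IsAddHaarMeasure
  rw [integral_mul_fderiv_eq_neg_fderiv_mul_of_integrable]
  · simp only [hg0, zero_mul, integral_zero, neg_zero]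
  · simp only [hg0, zero_mul]
    exact integrable_zero _ _ _
  · exact integrable_of_supp (hg.continuous.mul hfc) hfs.mul_left
  · exact integrable_of_supp (hg.continuous.mul hu.continuous) hc.mul_left
  · exact fun p _ => (hg.differentiable (by simp)) p
  · exact fun p _ => (hu.differentiable (by simp)) p

lemma integral_X (hu : ContDiff ℝ ∞ u) (hc : HasCompactSupport u) : ∫ p, X u p = 0 := by
  simpa [X] using integral_fderiv_const_mul 0 hu hc (1, 0, 0) (Or.inl rfl)

lemma integral_Y (hu : ContDiff ℝ ∞ u) (hc : HasCompactSupport u) : ∫ p, Y k u p = 0 := by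
  have h1 := integral_fderiv_const_mul 0 hu hc (0, 1, 0) (Or.inl rfl)
  have h2 := integral_fderiv_const_mul k hu hc (0, 0, 1) (Or.inr rfl)
  have hfc : ∀ w, Continuous (fun p => fderiv ℝ u p w) := fun w =>
    (hu.continuous_fderiv (by simp)).clm_apply continuous_const
  have hfs : ∀ w, HasCompactSupport (fun p => fderiv ℝ u p w) := fun w => hc.fderiv_apply ℝ w
  have hg : Continuous (fun p : R3 => ((p.1 ^ k : ℝ) : ℂ)) := by fun_prop
  have hY : ∀ p, Y k u p = ((p.1 ^ 0 : ℝ) : ℂ) * fderiv ℝ u p (0, 1, 0) +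
      ((p.1 ^ k : ℝ) : ℂ) * fderiv ℝ u p (0, 0, 1) := by
    intro p
    have : ((0, 1, p.1 ^ k) : R3) = (0, 1, 0) + (p.1 ^ k) • (0, 0, 1) := by simp
    rw [Y, this, map_add, map_smul]
    simp
  simp_rw [hY]
  rw [integral_add, h1, h2, add_zero]
  · simpa using integrable_of_supp (hfc _) (hfs _)
  · exact integrable_of_supp (hg.mul (hfc _)) (hfs _).mul_left

lemma integral_X_mul (hu : ContDiff ℝ ∞ u) (hv : ContDiff ℝ ∞ v) (hc : HasCompactSupport v) :
    ∫ p, X u p * v p = -∫ p, u p * X v p := by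
  have h := integral_X (hu.mul hv) hc.mul_left
  rw [X_mul (hu.differentiable (by simp)) (hv.differentiable (by simp)), integral_add] at h
  · linear_combination h
  · exact integrable_of_supp (hu.continuous.mul (contDiff_X hv).continuous)
      (hasCompactSupport_X hc).mul_left
  · exact integrable_of_supp ((contDiff_X hu).continuous.mul hv.continuous) hc.mul_left

lemma integral_Y_mul (hu : ContDiff ℝ ∞ u) (hv : ContDiff ℝ ∞ v) (hc : HasCompactSupport v) :
    ∫ p, Y k u p * v p = -∫ p, u p * Y k v p := by
  have h := integral_Y (k := k) (hu.mul hv) hc.mul_left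
  rw [Y_mul (hu.differentiable (by simp)) (hv.differentiable (by simp)), integral_add] at h
  · linear_combination h
  · exact integrable_of_supp (hu.continuous.mul (contDiff_Y hv).continuous)
      (hasCompactSupport_Y hc).mul_left
  · exact integrable_of_supp ((contDiff_Y hu).continuous.mul hv.continuous) hc.mul_left

/-- Multiplication by a function of `x` alone commutes with `[X, Y]`. -/
lemma XY_coeff_mul (ha : ContDiff ℝ ∞ a) (hv : ContDiff ℝ ∞ v) :
    XY k (fun p => Complex.I * (a p.1 : ℂ) * v p) =
      fun p => Complex.I * (a p.1 : ℂ) * XY k v p := by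
  have hA := contDiff_coeff ha
  have hd : ∀ {w : R3 → ℂ}, ContDiff ℝ ∞ w → Differentiable ℝ w := fun hw =>
    hw.differentiable (by simp)
  have hline : ∀ p w : R3, w.1 = 0 →
      fderiv ℝ (fun p : R3 => Complex.I * (a p.1 : ℂ)) p w = 0 := by
    intro p w hw
    have h1 : HasFDerivAt (fun q : R3 => Complex.I * (a q.1 : ℂ))
        ((fderiv ℝ (fun x : ℝ => Complex.I * (a x : ℂ)) p.1).comp
          (ContinuousLinearMap.fst ℝ ℝ (ℝ × ℝ))) p := by
      have hb : DifferentiableAt ℝ (fun x : ℝ => Complex.I * (a x : ℂ)) p.1 :=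
        ((contDiff_const.mul (Complex.ofRealCLM.contDiff.comp ha)).differentiable
          (n := ∞) (by simp)) p.1
      exact hb.hasFDerivAt.comp p (ContinuousLinearMap.fst ℝ ℝ (ℝ × ℝ)).hasFDerivAt
    rw [h1.fderiv]
    simp [hw]
  have hYA : ∀ p, Y k (fun p : R3 => Complex.I * (a p.1 : ℂ)) p = 0 := fun p => hline p _ rfl
  have hYXA : ∀ p, Y k (X fun p : R3 => Complex.I * (a p.1 : ℂ)) p = 0 := by
    intro p
    have h0 : (X fun p : R3 => Complex.I * (a p.1 : ℂ)) =
        fun p => Complex.I * ((deriv a p.1 : ℝ) : ℂ) := by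
      funext q
      have h1 : HasFDerivAt (fun q : R3 => Complex.I * (a q.1 : ℂ))
          ((ContinuousLinearMap.toSpanSingleton ℝ (Complex.I * ((deriv a q.1 : ℝ) : ℂ))).comp
            (ContinuousLinearMap.fst ℝ ℝ (ℝ × ℝ))) q := by
        have hb : HasDerivAt (fun x : ℝ => Complex.I * (a x : ℂ))
            (Complex.I * ((deriv a q.1 : ℝ) : ℂ)) q.1 :=
          (((ha.differentiable (by simp)) q.1).hasDerivAt.ofReal_comp).const_mul _
        exact hb.hasFDerivAt.comp q (ContinuousLinearMap.fst ℝ ℝ (ℝ × ℝ)).hasFDerivAt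
      rw [X, h1.fderiv]
      simp
    have ha' : ContDiff ℝ ∞ (deriv a) := ContDiff.deriv' (n := ∞) (by simpa using ha)
    rw [h0]
    have hb : DifferentiableAt ℝ (fun x : ℝ => Complex.I * ((deriv a x : ℝ) : ℂ)) p.1 :=
      ((contDiff_const.mul (Complex.ofRealCLM.contDiff.comp ha')).differentiable
        (n := ∞) (by simp)) p.1
    have h1 : HasFDerivAt (fun q : R3 => Complex.I * ((deriv a q.1 : ℝ) : ℂ))
        ((fderiv ℝ (fun x : ℝ => Complex.I * ((deriv a x : ℝ) : ℂ)) p.1).comp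
          (ContinuousLinearMap.fst ℝ ℝ (ℝ × ℝ))) p :=
      hb.hasFDerivAt.comp p (ContinuousLinearMap.fst ℝ ℝ (ℝ × ℝ)).hasFDerivAt
    rw [Y, h1.fderiv]
    simp
  set A : R3 → ℂ := fun p => Complex.I * (a p.1 : ℂ) with hAdef
  have e1 : Y k (fun p => A p * v p) = fun p => A p * Y k v p := by
    rw [Y_mul (hd hA) (hd hv)]
    funext p
    simp [hYA p]
  have e2 : Y k (fun p => A p * X v p + X A p * v p) =
      fun p => A p * Y k (X v) p + X A p * Y k v p := by
    have h1 := Y_mul (k := k) (hd hA) (hd (contDiff_X hv))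
    have h2 := Y_mul (k := k) (hd (contDiff_X hA)) (hd hv)
    funext p
    have h3 : Y k (fun p => A p * X v p + X A p * v p) p =
        Y k (fun p => A p * X v p) p + Y k (fun p => X A p * v p) p := by
      simp only [Y]
      rw [fderiv_fun_add ((hd (hA.mul (contDiff_X hv))) p) ((hd ((contDiff_X hA).mul hv)) p)]
      simp
    rw [h3, h1, h2]
    simp [hYA p, hYXA p]
  funext p
  change X (Y k fun p => A p * v p) p - Y k (X fun p => A p * v p) p = A p * XY k v p
  rw [e1, X_mul (hd hA) (hd (contDiff_Y hv)), X_mul (hd hA) (hd hv), e2, XY]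
  ring

/-- `Lt` is the transpose of `L`. -/
theorem integral_L_mul (ha : ContDiff ℝ ∞ a) (hu : ContDiff ℝ ∞ u) (hv : ContDiff ℝ ∞ v)
    (hc : HasCompactSupport v) : ∫ p, L k a u p * v p = ∫ p, u p * Lt k a v p := by
  have hA := contDiff_coeff ha
  set w : R3 → ℂ := fun p => Complex.I * (a p.1 : ℂ) * v p with hw
  have hwd : ContDiff ℝ ∞ w := hA.mul hv
  have hwc : HasCompactSupport w := hc.mul_left
  have hint : ∀ {f g : R3 → ℂ}, ContDiff ℝ ∞ f → ContDiff ℝ ∞ g → HasCompactSupport g →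
      Integrable (fun p => f p * g p) := fun hf hg h =>
    integrable_of_supp (hf.continuous.mul hg.continuous) h.mul_left
  have l1 : ∀ p, L k a u p * v p = -(X (X u) p * v p) - Y k (Y k u) p * v p
      + (X (Y k u) p * w p - Y k (X u) p * w p) := by
    intro p
    simp only [L, XY, hw]
    ring
  have l2 : ∀ p, u p * Lt k a v p = -(u p * X (X v) p) - u p * Y k (Y k v) p
      + (u p * Y k (X w) p - u p * X (Y k w) p) := by
    intro p
    have h := congrFun (XY_coeff_mul (k := k) ha hv) p
    simp only [XY] at h
    simp only [Lt, L, XY]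
    push_cast
    linear_combination (u p) * h
  have split : ∀ {f₁ f₂ f₃ f₄ : R3 → ℂ}, Integrable f₁ → Integrable f₂ → Integrable f₃ →
      Integrable f₄ → ∫ p, (-f₁ p - f₂ p + (f₃ p - f₄ p)) =
        -(∫ p, f₁ p) - (∫ p, f₂ p) + ((∫ p, f₃ p) - ∫ p, f₄ p) := by
    intro f₁ f₂ f₃ f₄ h₁ h₂ h₃ h₄
    change ∫ p, ((-f₁ - f₂) + (f₃ - f₄)) p = _
    rw [integral_add' (h₁.neg.sub h₂) (h₃.sub h₄), integral_sub' h₁.neg h₂,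
      integral_sub' h₃ h₄, integral_neg']
  have cX : ∀ {f : R3 → ℂ}, ContDiff ℝ ∞ f → ContDiff ℝ ∞ (X f) := contDiff_X
  have cY : ∀ {f : R3 → ℂ}, ContDiff ℝ ∞ f → ContDiff ℝ ∞ (Y k f) := contDiff_Y
  have sX : ∀ {f : R3 → ℂ}, HasCompactSupport f → HasCompactSupport (X f) := hasCompactSupport_X
  have sY : ∀ {f : R3 → ℂ}, HasCompactSupport f → HasCompactSupport (Y k f) := hasCompactSupport_Y
  simp_rw [l1, l2]
  rw [split (hint (cX (cX hu)) hv hc) (hint (cY (cY hu)) hv hc) (hint (cX (cY hu)) hwd hwc)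
      (hint (cY (cX hu)) hwd hwc),
    split (hint hu (cX (cX hv)) (sX (sX hc))) (hint hu (cY (cY hv)) (sY (sY hc)))
      (hint hu (cY (cX hwd)) (sY (sX hwc))) (hint hu (cX (cY hwd)) (sX (sY hwc))),
    integral_X_mul (cX hu) hv hc, integral_X_mul hu (cX hv) (sX hc),
    integral_Y_mul (cY hu) hv hc, integral_Y_mul hu (cY hv) (sY hc),
    integral_X_mul (cY hu) hwd hwc, integral_Y_mul hu (cX hwd) (sX hwc),
    integral_Y_mul (cX hu) hwd hwc, integral_X_mul hu (cY hwd) (sY hwc)]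
  ring

end Transpose

end DoubleChar

end

/-! Part (1) is a quasimode argument. If `L` were solvable in `L²`, uniform boundedness would
exclude test functions `ψ` with support shrinking to `0` and `‖Lt ψ‖ / ‖ψ‖` tending to `0`
(`not_locallySolvableL2_of_quasimodes`).

Such `ψ` come from the factorization `Lt = -(X - iY)(X + iY) + i(1 - a)[X, Y]`. The function `zeta`
is annihilated by `X + iY`, while `zbar` is annihilated by `X - iY` and sent to the constant `2r` by
`X + iY`. Hence `zbar ^ m * zeta⁻¹ ^ N` satisfies `Lt u = 0` when `a` is constantly `2m + 1`, for
every `m` if `k = 1` and for `m = 0` otherwise (`Lt_model`). For odd `k` the real part of `zeta` is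
bounded below and grows, so these solutions decay. The dilation `(r x, r y, r ^ (k + 1) t)`
concentrates them at the origin and scales the constant coefficient operator by `r ^ 2`. Since `a -
a 0` vanishes to third order, the error from the variable coefficient is `O(r ^ 2 * r ^ (-3)) = O(1
/ r)`; the cutoff errors are `O(1 / r)` too, because `zeta` is at least of size `r ^ 2` away from
the origin. Negative values of `a 0` follow by complex conjugation.

Part (2) takes `k = 1` and `a = 1 - x ^ 4`, to which part (1) applies. Solvability follows by
duality from `‖u‖² ≤ C (‖Lt u‖² + ‖∂_t Lt u‖²)` for `u` supported in `|x| ≤ 1/4`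
(`integral_norm_sq_le`). After a Fourier transform in `t`, with `θ` the dual variable, the quadratic
form of `Lt` is `‖Xu‖² + ‖Yu‖² + θ (‖u‖² - ‖x²u‖²)`. The commutator inequality `|θ| ‖u‖² ≤ ‖Xu‖² +
‖Yu‖²` leaves at least `|θ| ‖x²u‖²` for negative `θ`. The uncertainty principle in `x` bounds this
below by a multiple of `‖u‖² / |θ|` when `|θ|` is large and the form is small; this factor `|θ|` is
the lost derivative. -/

noncomputable section

namespace DoubleChar

/-! ### Pairings and Cauchy–Schwarz in `L²`. -/

section SquareIntegrable

variable {α : Type*} [MeasurableSpace α] {μ : Measure α} {f g : α → ℂ}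

lemma inner_toLp_toLp (hf : MemLp f 2 μ) (hg : MemLp g 2 μ) :
    inner ℂ (hf.toLp f) (hg.toLp g) = ∫ x, (starRingEnd ℂ) (f x) * g x ∂μ := by
  rw [L2.inner_def]
  refine integral_congr_ae ?_
  filter_upwards [hf.coeFn_toLp, hg.coeFn_toLp] with x h1 h2
  rw [h1, h2, RCLike.inner_apply]
  ring

lemma norm_toLp_sq (hf : MemLp f 2 μ) : ‖hf.toLp f‖ ^ 2 = ∫ x, ‖f x‖ ^ 2 ∂μ := by
  have h := inner_toLp_toLp hf hf
  rw [inner_self_eq_norm_sq_to_K] at h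
  have h2 : ∀ x, (starRingEnd ℂ) (f x) * f x = ((‖f x‖ ^ 2 : ℝ) : ℂ) := fun x => by
    rw [mul_comm, Complex.mul_conj, Complex.normSq_eq_norm_sq]
  simp_rw [h2] at h
  rw [integral_complex_ofReal] at h
  refine Complex.ofReal_injective ?_
  rw [← h]
  simp

lemma memLp_conj (hf : MemLp f 2 μ) : MemLp (fun x => (starRingEnd ℂ) (f x)) 2 μ :=
  hf.star

lemma norm_integral_mul_sq_le (hf : MemLp f 2 μ) (hg : MemLp g 2 μ) :
    ‖∫ x, f x * g x ∂μ‖ ^ 2 ≤ (∫ x, ‖f x‖ ^ 2 ∂μ) * ∫ x, ‖g x‖ ^ 2 ∂μ := by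
  have h := inner_toLp_toLp (memLp_conj hf) hg
  simp only [Complex.conj_conj] at h
  have h1 := norm_toLp_sq (memLp_conj hf)
  simp only [RCLike.norm_conj] at h1
  rw [← h, ← norm_toLp_sq hg, ← h1, ← mul_pow]
  gcongr
  exact norm_inner_le_norm _ _

lemma memLp_of_continuous_of_hasCompactSupport {E : Type*} [TopologicalSpace E]
    [MeasurableSpace E] [OpensMeasurableSpace E] [SecondCountableTopology E]
    {μ : Measure E} [IsFiniteMeasureOnCompacts μ] {u : E → ℂ}
    (hu : Continuous u) (hc : HasCompactSupport u) : MemLp u 2 μ :=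
  hu.memLp_of_hasCompactSupport hc

end SquareIntegrable

/-! ### Quasimodes exclude solvability in `L²`. -/

instance : (volume : Measure (ℝ × ℝ)).IsAddHaarMeasure :=
  inferInstanceAs ((volume : Measure ℝ).prod (volume : Measure ℝ)).IsAddHaarMeasure

instance : (volume : Measure R3).IsAddHaarMeasure :=
  inferInstanceAs ((volume : Measure ℝ).prod (volume : Measure (ℝ × ℝ))).IsAddHaarMeasure

/-- If `Lt` does not satisfy an `L²` lower bound on test functions with small support, then `L` is
not locally solvable in `L²`. -/
theorem not_locallySolvableL2_of_quasimodes {k : ℕ} {a : ℝ → ℝ} (ha : ContDiff ℝ ∞ a)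
    (h : ∀ ρ > 0, ∀ ε > 0, ∃ ψ : R3 → ℂ, ContDiff ℝ ∞ ψ ∧ HasCompactSupport ψ ∧
      tsupport ψ ⊆ Metric.closedBall 0 ρ ∧ 0 < ∫ p, ‖ψ p‖ ^ 2 ∧
      ∫ p, ‖Lt k a ψ p‖ ^ 2 ≤ ε * ∫ p, ‖ψ p‖ ^ 2) :
    ¬ LocallySolvableL2 k a := by
  intro hsol
  have hpos : ∀ n : ℕ, (0 : ℝ) < 1 / ((n : ℝ) + 1) := fun n => Nat.one_div_pos_of_nat
  choose ψ hψ hψc hψs hψ0 hψL using fun n : ℕ => h (1 / ((n : ℝ) + 1)) (hpos n)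
    ((1 / ((n : ℝ) + 1)) ^ 2) (pow_pos (hpos n) 2)
  have hmem : ∀ n, MemLp (ψ n) 2 volume := fun n =>
    memLp_of_continuous_of_hasCompactSupport (hψ n).continuous (hψc n)
  have hLc : ∀ n, HasCompactSupport (Lt k a (ψ n)) := fun n =>
    (hψc n).of_isClosed_subset (isClosed_tsupport _) tsupport_L_subset
  have hmemL : ∀ n, MemLp (Lt k a (ψ n)) 2 volume := fun n =>
    memLp_of_continuous_of_hasCompactSupport (contDiff_L ha.neg (hψ n)).continuous (hLc n)
  -- The inner product is conjugate linear on the left, so conjugating `ψ n` makes `inner (v n) f`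
  -- equal to `∫ f ψ n`.
  set v : ℕ → Lp ℂ 2 (volume : Measure R3) := fun n => (memLp_conj (hmem n)).toLp _ with hv
  have hvn : ∀ n, ‖v n‖ ^ 2 = ∫ p, ‖ψ n p‖ ^ 2 := fun n => by
    simpa only [RCLike.norm_conj] using norm_toLp_sq (memLp_conj (hmem n))
  have hv0 : ∀ n, 0 < ‖v n‖ := fun n => by
    have := hψ0 n
    rw [← hvn n] at this
    exact (norm_nonneg _).lt_of_ne fun h0 => by simp [← h0] at this
  -- The normalization gives `G n` norm `n + 1`, while `‖Lt (ψ n)‖ ≤ ‖ψ n‖ / (n + 1)` keeps `G n f`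
  -- bounded for each `f`: this contradicts Banach–Steinhaus.
  set c : ℕ → ℝ := fun n => ((n : ℝ) + 1) / ‖v n‖ with hc
  have hc0 : ∀ n, 0 < c n := fun n => div_pos (by positivity) (hv0 n)
  set G : ℕ → Lp ℂ 2 (volume : Measure R3) →L[ℂ] ℂ := fun n => (c n : ℂ) • innerSL ℂ (v n) with hG
  have hGn : ∀ n, ‖G n‖ = (n : ℝ) + 1 := fun n => by
    rw [hG, norm_smul, innerSL_apply_norm, Complex.norm_real, Real.norm_of_nonneg (hc0 n).le]
    exact div_mul_cancel₀ _ (hv0 n).ne'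
  obtain ⟨C, hC⟩ : ∃ C, ∀ n, ‖G n‖ ≤ C := by
    refine banach_steinhaus fun f => ?_
    obtain ⟨V, hV0, u, hu, huf⟩ := hsol f (Lp.memLp f)
    obtain ⟨R, hR, hRV⟩ := Metric.nhds_basis_closedBall.mem_iff.1 (V.isOpen.mem_nhds hV0)
    obtain ⟨n₀, hn₀⟩ := exists_nat_one_div_lt hR
    set K : Set R3 := Metric.closedBall 0 R with hK
    have hKc : IsCompact K := isCompact_closedBall _ _
    have huK : MemLp (K.indicator u) 2 volume :=
      (memLp_indicator_iff_restrict hKc.measurableSet).2 (hu K hKc hRV)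
    set M : ℝ := ∫ p, ‖K.indicator u p‖ ^ 2 with hM
    have hM0 : 0 ≤ M := integral_nonneg fun p => by positivity
    -- Once `ψ n` is supported in `K`, it may be tested against the solution `u` for this `f`, and
    -- `∫ f ψ n = ∫ u Lt (ψ n)`. The finitely many earlier `n` are covered by operator norms, so the
    -- neighbourhood may depend on `f`.
    have hlarge : ∀ n, n₀ ≤ n → ‖G n f‖ ≤ √M := by
      intro n hn
      have hsub : tsupport (ψ n) ⊆ K := (hψs n).trans (Metric.closedBall_subset_closedBall
        ((Nat.one_div_le_one_div hn).trans hn₀.le))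
      let Ψ : 𝓓(V, ℂ) := ⟨ψ n, hψ n, hψc n, hsub.trans hRV⟩
      have e1 : ∫ p, f p * ψ n p = ∫ p, K.indicator u p * Lt k a (ψ n) p := by
        refine (huf Ψ).symm.trans ?_
        refine integral_congr_ae (Filter.Eventually.of_forall fun p => ?_)
        change u p * Lt k a (ψ n) p = _
        by_cases hp : p ∈ K
        · simp [hp]
        · have : Lt k a (ψ n) p = 0 := image_eq_zero_of_notMem_tsupport
            fun h' => hp (hsub (tsupport_L_subset h'))
          simp [this]
      have e2 : inner ℂ (v n) f = ∫ p, f p * ψ n p := by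
        have := inner_toLp_toLp (memLp_conj (hmem n)) (Lp.memLp f)
        rw [Lp.toLp_coeFn] at this
        rw [this]
        simp [mul_comm]
      have e3 := norm_integral_mul_sq_le huK (hmemL n)
      rw [← e1, ← e2] at e3
      have e4 : ‖inner ℂ (v n) f‖ ^ 2 ≤ M * ((1 / ((n : ℝ) + 1)) ^ 2 * ‖v n‖ ^ 2) := by
        refine e3.trans (mul_le_mul_of_nonneg_left ?_ hM0)
        rw [hvn n]
        exact hψL n
      refine Real.le_sqrt_of_sq_le ?_
      have e5 : ‖G n f‖ = c n * ‖inner ℂ (v n) f‖ := by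
        simp [hG, abs_of_pos (hc0 n)]
      rw [e5, mul_pow]
      calc c n ^ 2 * ‖inner ℂ (v n) f‖ ^ 2
          ≤ c n ^ 2 * (M * ((1 / ((n : ℝ) + 1)) ^ 2 * ‖v n‖ ^ 2)) := by gcongr
        _ = M := by
          have := (hv0 n).ne'
          have h2 : (n : ℝ) + 1 ≠ 0 := by positivity
          simp only [hc]
          field_simp
    refine ⟨√M + ((n₀ : ℝ) + 1) * ‖f‖, fun n => ?_⟩
    rcases le_total n₀ n with hn | hn
    · exact (hlarge n hn).trans (le_add_of_nonneg_right (by positivity))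
    · refine ((G n).le_opNorm f).trans ?_
      rw [hGn]
      have : (n : ℝ) ≤ n₀ := by exact_mod_cast hn
      have h1 : ((n : ℝ) + 1) * ‖f‖ ≤ ((n₀ : ℝ) + 1) * ‖f‖ := by gcongr
      linarith [Real.sqrt_nonneg M]
  obtain ⟨n, hn⟩ := exists_nat_gt C
  have := hC n
  rw [hGn] at this
  linarith

/-- The vector field `∂_t`. -/
def T (u : R3 → ℂ) : R3 → ℂ := fun p => fderiv ℝ u p (0, 0, 1)

/-! ### Commutator, Leibniz and conjugation rules. -/

section Calculus

variable {u v : R3 → ℂ} {k : ℕ} {a : ℝ → ℝ}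

lemma contDiff_T (hu : ContDiff ℝ ∞ u) : ContDiff ℝ ∞ (T u) := by
  have h : ContDiff ℝ ∞ (fderiv ℝ u) := hu.fderiv_right (by simp)
  exact h.clm_apply contDiff_const

lemma tsupport_T_subset : tsupport (T u) ⊆ tsupport u :=
  (closure_mono fun p hp => by
    contrapose! hp
    simp [T, Function.notMem_support.1 hp]).trans (tsupport_fderiv_subset ℝ (f := u))

lemma hasCompactSupport_T (hc : HasCompactSupport u) : HasCompactSupport (T u) :=
  hc.of_isClosed_subset (isClosed_tsupport _) tsupport_T_subset

lemma hasCompactSupport_L (hc : HasCompactSupport u) : HasCompactSupport (L k a u) :=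
  hc.of_isClosed_subset (isClosed_tsupport _) tsupport_L_subset

lemma X_add (hu : Differentiable ℝ u) (hv : Differentiable ℝ v) :
    X (fun p => u p + v p) = fun p => X u p + X v p := by
  funext p
  simp only [X, fderiv_fun_add (hu p) (hv p)]
  simp

lemma Y_add (hu : Differentiable ℝ u) (hv : Differentiable ℝ v) :
    Y k (fun p => u p + v p) = fun p => Y k u p + Y k v p := by
  funext p
  simp only [Y, fderiv_fun_add (hu p) (hv p)]
  simp

lemma Y_eq (p : R3) : Y k u p = fderiv ℝ u p (0, 1, 0) + ((p.1 ^ k : ℝ) : ℂ) * T u p := by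
  have : ((0, 1, p.1 ^ k) : R3) = (0, 1, 0) + (p.1 ^ k) • (0, 0, 1) := by simp
  rw [Y, this, map_add, map_smul]
  simp [T]

/-- The commutator of `X` and `Y` is `k x ^ (k - 1) ∂_t`. -/
lemma XY_eq (hu : ContDiff ℝ ∞ u) (p : R3) :
    XY k u p = ((k * p.1 ^ (k - 1) : ℝ) : ℂ) * T u p := by
  have hd : DifferentiableAt ℝ (fderiv ℝ u) p :=
    ((hu.fderiv_right (m := ∞) (by simp)).differentiable (by simp)) p
  have h1 : HasFDerivAt (fun q : R3 => ((0, 1, q.1 ^ k) : R3))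
      ((0 : R3 →L[ℝ] ℝ).prod ((0 : R3 →L[ℝ] ℝ).prod
        ((k * p.1 ^ (k - 1)) • ContinuousLinearMap.fst ℝ ℝ (ℝ × ℝ)))) p :=
    (hasFDerivAt_const _ _).prodMk ((hasFDerivAt_const _ _).prodMk
      ((hasDerivAt_pow k p.1).comp_hasFDerivAt p
        (ContinuousLinearMap.fst ℝ ℝ (ℝ × ℝ)).hasFDerivAt))
  have hY : HasFDerivAt (Y k u) _ p := hd.hasFDerivAt.clm_apply h1
  have hX : HasFDerivAt (X u) _ p := hd.hasFDerivAt.clm_apply (hasFDerivAt_const _ _)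
  have hs : IsSymmSndFDerivAt ℝ u p := hu.contDiffAt.isSymmSndFDerivAt (by
    simpa using WithTop.coe_le_coe.2 (le_top : (2 : ℕ∞) ≤ ⊤))
  have h2 : ((0, 0, (k : ℝ) * p.1 ^ (k - 1)) : R3) = (k * p.1 ^ (k - 1) : ℝ) • (0, 0, 1) := by
    simp
  have h3 : X (Y k u) p = fderiv ℝ (fderiv ℝ u) p (1, 0, 0) (0, 1, p.1 ^ k) +
      ((k * p.1 ^ (k - 1) : ℝ) : ℂ) * T u p := by
    rw [X, hY.fderiv]
    simp only [add_apply, ContinuousLinearMap.comp_apply,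
      ContinuousLinearMap.flip_apply, ContinuousLinearMap.prod_apply, smul_apply, zero_apply,
      ContinuousLinearMap.coe_fst', smul_eq_mul, mul_one]
    rw [h2, map_smul, T, Complex.real_smul]
    ring
  have h4 : Y k (X u) p = fderiv ℝ (fderiv ℝ u) p (0, 1, p.1 ^ k) (1, 0, 0) := by
    rw [Y, hX.fderiv]
    simp
  rw [XY, h3, h4, hs.eq]
  ring

/-- The Leibniz rule for the second order operator `L`. -/
lemma L_mul (hu : ContDiff ℝ ∞ u) (hv : ContDiff ℝ ∞ v) (p : R3) :
    L k a (fun q => u q * v q) p = u p * L k a v p - 2 * (X u p * X v p)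
      - 2 * (Y k u p * Y k v p) + L k a u p * v p := by
  have hd : ∀ {w : R3 → ℂ}, ContDiff ℝ ∞ w → Differentiable ℝ w := fun hw =>
    hw.differentiable (by simp)
  have cX : ∀ {f : R3 → ℂ}, ContDiff ℝ ∞ f → ContDiff ℝ ∞ (X f) := contDiff_X
  have cY : ∀ {f : R3 → ℂ}, ContDiff ℝ ∞ f → ContDiff ℝ ∞ (Y k f) := contDiff_Y
  simp only [L, XY]
  rw [X_mul (hd hu) (hd hv), Y_mul (hd hu) (hd hv),
    X_add (hd (hu.mul (cX hv))) (hd ((cX hu).mul hv)),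
    X_add (hd (hu.mul (cY hv))) (hd ((cY hu).mul hv)),
    Y_add (hd (hu.mul (cX hv))) (hd ((cX hu).mul hv)),
    Y_add (hd (hu.mul (cY hv))) (hd ((cY hu).mul hv)),
    X_mul (hd hu) (hd (cX hv)), X_mul (hd (cX hu)) (hd hv),
    X_mul (hd hu) (hd (cY hv)), X_mul (hd (cY hu)) (hd hv),
    Y_mul (hd hu) (hd (cX hv)), Y_mul (hd (cX hu)) (hd hv),
    Y_mul (hd hu) (hd (cY hv)), Y_mul (hd (cY hu)) (hd hv)]
  ring

lemma fderiv_conj {E : Type*} [NormedAddCommGroup E] [NormedSpace ℝ E] {g : E → ℂ} (x v : E) :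
    fderiv ℝ (fun q => (starRingEnd ℂ) (g q)) x v = (starRingEnd ℂ) (fderiv ℝ g x v) :=
  DFunLike.congr_fun (Complex.conjCLE.comp_fderiv (f := g) (x := x)) v

lemma X_conj : X (fun q => (starRingEnd ℂ) (u q)) = fun q => (starRingEnd ℂ) (X u q) :=
  funext fun p => fderiv_conj p _

lemma Y_conj : Y k (fun q => (starRingEnd ℂ) (u q)) = fun q => (starRingEnd ℂ) (Y k u q) :=
  funext fun p => fderiv_conj p _

/-- `X` and `Y` are real, so conjugation only changes the sign of the `i` in front of `a`. This
reduces negative `a 0` to positive `a 0`. -/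
lemma Lt_conj (p : R3) :
    Lt k a (fun q => (starRingEnd ℂ) (u q)) p = (starRingEnd ℂ) (Lt k (fun x => -a x) u p) := by
  simp only [Lt, L, XY, X_conj, Y_conj]
  simp

end Calculus

/-! ### Model solutions for constant `a`. -/

section Model

variable {k : ℕ} {r : ℝ} {m N : ℕ} {a : ℝ → ℝ}

lemma contDiff_cx : ContDiff ℝ ∞ (fun p : R3 => (p.1 : ℂ)) :=
  Complex.ofRealCLM.contDiff.comp contDiff_fst

lemma contDiff_cy : ContDiff ℝ ∞ (fun p : R3 => (p.2.1 : ℂ)) :=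
  Complex.ofRealCLM.contDiff.comp (contDiff_fst.comp contDiff_snd)

lemma contDiff_ct : ContDiff ℝ ∞ (fun p : R3 => (p.2.2 : ℂ)) :=
  Complex.ofRealCLM.contDiff.comp (contDiff_snd.comp contDiff_snd)

/-- The antiholomorphic coordinate `r (x - i y)`. -/
def zbar (r : ℝ) (p : R3) : ℂ := r * (p.1 - Complex.I * p.2.1)

/-- A function with positive real part which is annihilated by `X + i Y`; the parameter `r` is
that of the dilation `(r x, r y, r ^ (k + 1) t)`. -/
def zeta (k : ℕ) (r : ℝ) (p : R3) : ℂ :=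
  2 + (r : ℂ) ^ (k + 1) * (p.1 : ℂ) ^ (k + 1) / (k + 1)
    - (r : ℂ) ^ 2 * ((p.1 : ℂ) + Complex.I * p.2.1) ^ 2 / 4 + Complex.I * (r : ℂ) ^ (k + 1) * p.2.2

/-- The derivative `X zeta`. -/
def Xzeta (k : ℕ) (r : ℝ) (p : R3) : ℂ :=
  (r : ℂ) ^ (k + 1) * (p.1 : ℂ) ^ k - (r : ℂ) ^ 2 * ((p.1 : ℂ) + Complex.I * p.2.1) / 2

/-- For suitable `m` and `a`, an exact solution of `Lt u = 0`. -/
def model (k : ℕ) (r : ℝ) (m N : ℕ) (p : R3) : ℂ := zbar r p ^ m * (zeta k r p)⁻¹ ^ N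

lemma contDiff_zbar : ContDiff ℝ ∞ (zbar r) :=
  contDiff_const.mul (contDiff_cx.sub (contDiff_const.mul contDiff_cy))

lemma contDiff_zeta : ContDiff ℝ ∞ (zeta k r) :=
  ((contDiff_const.add ((contDiff_const.mul (contDiff_cx.pow _)).div_const _)).sub
    ((contDiff_const.mul ((contDiff_cx.add (contDiff_const.mul contDiff_cy)).pow 2)).div_const
      _)).add (contDiff_const.mul contDiff_ct)

lemma fderiv_eq_of_hasDerivAt {u : R3 → ℂ} {p v : R3} {d : ℂ} (hu : Differentiable ℝ u)
    (h : HasDerivAt (fun s : ℝ => u (p + s • v)) d 0) : fderiv ℝ u p v = d := by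
  rw [← (hu p).lineDeriv_eq_fderiv]
  exact HasLineDerivAt.lineDeriv h

lemma hasDerivAt_line (x b : ℝ) : HasDerivAt (fun s : ℝ => ((x + s * b : ℝ) : ℂ)) b 0 := by
  have : HasDerivAt (fun s : ℝ => x + s * b) b 0 := by
    simpa using ((hasDerivAt_id (0 : ℝ)).mul_const b).const_add x
  exact this.ofReal_comp

lemma fderiv_zbar (p v : R3) : fderiv ℝ (zbar r) p v = r * (v.1 - Complex.I * v.2.1) := by
  refine fderiv_eq_of_hasDerivAt (contDiff_zbar.differentiable (by simp)) ?_
  exact ((hasDerivAt_line p.1 v.1).sub ((hasDerivAt_line p.2.1 v.2.1).const_mul _)).const_mul _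

lemma fderiv_zeta (p v : R3) : fderiv ℝ (zeta k r) p v =
    (r : ℂ) ^ (k + 1) * (p.1 : ℂ) ^ k * v.1
      - (r : ℂ) ^ 2 * ((p.1 : ℂ) + Complex.I * p.2.1) / 2 * (v.1 + Complex.I * v.2.1)
      + Complex.I * (r : ℂ) ^ (k + 1) * v.2.2 := by
  refine fderiv_eq_of_hasDerivAt (contDiff_zeta.differentiable (by simp)) ?_
  have hx := hasDerivAt_line p.1 v.1
  have hy := hasDerivAt_line p.2.1 v.2.1
  have ht := hasDerivAt_line p.2.2 v.2.2
  have h := (((((hx.pow (k + 1)).const_mul ((r : ℂ) ^ (k + 1))).div_const ((k : ℂ) + 1)).const_add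
    2).sub ((((hx.add (hy.const_mul Complex.I)).pow 2).const_mul ((r : ℂ) ^ 2)).div_const 4)).add
    (ht.const_mul (Complex.I * (r : ℂ) ^ (k + 1)))
  have hk : ((k : ℂ) + 1) ≠ 0 := by exact_mod_cast Nat.succ_ne_zero k
  refine HasDerivAt.congr_deriv h ?_
  simp
  field_simp
  ring

lemma X_zeta (p : R3) : X (zeta k r) p = Xzeta k r p := by
  rw [X, fderiv_zeta, Xzeta]
  simp

lemma Y_zeta (p : R3) : Y k (zeta k r) p = Complex.I * Xzeta k r p := by
  rw [Y, fderiv_zeta, Xzeta]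
  push_cast
  ring

/-- Bernoulli's inequality for `(1 + (s ^ 2 - 1)) ^ (n + 1)`, with `k + 1 = 2 * (n + 1)`. -/
lemma pow_succ_div_ge {k : ℕ} (hk : Odd k) (s : ℝ) : s ^ 2 / 2 - 1 / 2 ≤ s ^ (k + 1) / (k + 1) := by
  obtain ⟨n, rfl⟩ := hk
  have h := one_add_mul_le_pow (a := s ^ 2 - 1) (by nlinarith [sq_nonneg s]) (n + 1)
  have e : (1 + (s ^ 2 - 1)) ^ (n + 1) = s ^ (2 * n + 1 + 1) := by
    rw [show 2 * n + 1 + 1 = 2 * (n + 1) by ring, pow_mul]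
    ring
  rw [e] at h
  rw [le_div_iff₀ (by positivity)]
  push_cast at h ⊢
  nlinarith

lemma zeta_eq (p : R3) : zeta k r p =
    ((2 + (r * p.1) ^ (k + 1) / (k + 1) - r ^ 2 * (p.1 ^ 2 - p.2.1 ^ 2) / 4 : ℝ) : ℂ)
      + ((-r ^ 2 * p.1 * p.2.1 / 2 + r ^ (k + 1) * p.2.2 : ℝ) : ℂ) * Complex.I := by
  rw [zeta]
  push_cast
  linear_combination (-(r : ℂ) ^ 2 * p.2.1 ^ 2 / 4) * Complex.I_sq

lemma zeta_re (p : R3) : (zeta k r p).re =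
    2 + (r * p.1) ^ (k + 1) / (k + 1) - r ^ 2 * (p.1 ^ 2 - p.2.1 ^ 2) / 4 := by
  simp only [zeta_eq, Complex.add_re, Complex.mul_re, Complex.ofReal_re, Complex.ofReal_im,
    Complex.I_re, Complex.I_im]
  ring

lemma zeta_im (p : R3) : (zeta k r p).im = -r ^ 2 * p.1 * p.2.1 / 2 + r ^ (k + 1) * p.2.2 := by
  simp only [zeta_eq, Complex.add_im, Complex.mul_im, Complex.ofReal_re, Complex.ofReal_im,
    Complex.I_re, Complex.I_im]
  ring

/-- The square of `x + iy` in `zeta` is also killed by `X + iY`; it supplies growth in `y` at the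
price of `-(r x) ^ 2 / 4`, which the even power of `r x` absorbs. -/
lemma norm_zeta_ge (hk : Odd k) (p : R3) :
    3 / 2 + ((r * p.1) ^ 2 + (r * p.2.1) ^ 2) / 4 ≤ ‖zeta k r p‖ := by
  refine le_trans ?_ (Complex.re_le_norm _)
  rw [zeta_re]
  nlinarith [pow_succ_div_ge hk (r * p.1)]

lemma one_le_norm_zeta (hk : Odd k) (p : R3) : 1 ≤ ‖zeta k r p‖ := by
  nlinarith [norm_zeta_ge (r := r) hk p, sq_nonneg (r * p.1), sq_nonneg (r * p.2.1)]

lemma zeta_ne_zero (hk : Odd k) (p : R3) : zeta k r p ≠ 0 := fun h => by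
  have := one_le_norm_zeta (r := r) hk p
  rw [h, norm_zero] at this
  linarith

/-- The imaginary part is `r ^ (k + 1) t` up to `r ^ 2 x y / 2`, and the latter is dominated by the
quadratic growth of the real part. -/
lemma abs_t_le (hk : Odd k) (p : R3) : |r ^ (k + 1) * p.2.2| ≤ 2 * ‖zeta k r p‖ := by
  have h1 := Complex.abs_im_le_norm (zeta k r p)
  have h2 := norm_zeta_ge (r := r) hk p
  rw [zeta_im] at h1
  rw [abs_le] at h1 ⊢
  constructor <;> nlinarith [sq_nonneg (r * p.1 - r * p.2.1), sq_nonneg (r * p.1 + r * p.2.1)]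

lemma contDiff_model (hk : Odd k) : ContDiff ℝ ∞ (model k r m N) :=
  (contDiff_zbar.pow m).mul ((contDiff_zeta.inv (zeta_ne_zero hk)).pow N)

lemma fderiv_model (hk : Odd k) (p v : R3) : fderiv ℝ (model k r m N) p v =
    m * zbar r p ^ (m - 1) * fderiv ℝ (zbar r) p v * (zeta k r p)⁻¹ ^ N
      - N * zbar r p ^ m * (zeta k r p)⁻¹ ^ (N + 1) * fderiv ℝ (zeta k r) p v := by
  refine fderiv_eq_of_hasDerivAt ((contDiff_model hk).differentiable (by simp)) ?_
  have hc : HasDerivAt (fun s : ℝ => zbar r (p + s • v)) (fderiv ℝ (zbar r) p v) 0 :=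
    ((contDiff_zbar.differentiable (by simp)) p).hasFDerivAt.hasLineDerivAt v
  have hz : HasDerivAt (fun s : ℝ => zeta k r (p + s • v)) (fderiv ℝ (zeta k r) p v) 0 :=
    ((contDiff_zeta.differentiable (by simp)) p).hasFDerivAt.hasLineDerivAt v
  have h := (hc.pow m).mul ((hz.inv (zeta_ne_zero hk _)).pow N)
  refine HasDerivAt.congr_deriv h ?_
  have hz0 := zeta_ne_zero (r := r) hk p
  -- The power rule produces the truncated exponent `N - 1`, so `N = 0` is separate.
  rcases N with _ | N
  · simp
  · simp only [Nat.add_sub_cancel]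
    push_cast
    simp only [pow_succ, Pi.inv_apply, Pi.pow_apply, zero_smul, add_zero]
    field_simp
    ring

lemma X_model (hk : Odd k) (p : R3) : X (model k r m N) p =
    m * r * zbar r p ^ (m - 1) * (zeta k r p)⁻¹ ^ N
      - N * zbar r p ^ m * (zeta k r p)⁻¹ ^ (N + 1) * Xzeta k r p := by
  have hz : fderiv ℝ (zeta k r) p (1, 0, 0) = Xzeta k r p := X_zeta p
  rw [X, fderiv_model hk, hz, fderiv_zbar]
  push_cast
  ring

lemma Y_model (hk : Odd k) (p : R3) : Y k (model k r m N) p =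
    -Complex.I * (m * r * zbar r p ^ (m - 1) * (zeta k r p)⁻¹ ^ N
      + N * zbar r p ^ m * (zeta k r p)⁻¹ ^ (N + 1) * Xzeta k r p) := by
  have hz : fderiv ℝ (zeta k r) p (0, 1, p.1 ^ k) = Complex.I * Xzeta k r p := Y_zeta p
  rw [Y, fderiv_model hk, hz, fderiv_zbar]
  push_cast
  ring

lemma T_model (hk : Odd k) (p : R3) : T (model k r m N) p =
    -(Complex.I * N * (r : ℂ) ^ (k + 1) * zbar r p ^ m * (zeta k r p)⁻¹ ^ (N + 1)) := by
  rw [T, fderiv_model hk, fderiv_zeta, fderiv_zbar]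
  simp
  ring

/-- `(X - iY)(X + iY) = X² + Y² + i[X, Y]`. The factor adapted to `zeta` stands on the right, so it
acts first. -/
lemma L_eq_factored {u : R3 → ℂ} (hu : ContDiff ℝ ∞ u) (p : R3) :
    L k a u p = -(X (fun q => X u q + Complex.I * Y k u q) p
      - Complex.I * Y k (fun q => X u q + Complex.I * Y k u q) p)
      + Complex.I * (1 + a p.1) * XY k u p := by
  have hd : ∀ {w : R3 → ℂ}, ContDiff ℝ ∞ w → Differentiable ℝ w := fun hw =>
    hw.differentiable (by simp)
  have hX := contDiff_X hu
  have hY := contDiff_Y (k := k) hu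
  have hI : ContDiff ℝ ∞ (fun _ : R3 => Complex.I) := contDiff_const
  rw [X_add (hd hX) (hd (hI.mul hY)), Y_add (hd hX) (hd (hI.mul hY)),
    X_mul (hd hI) (hd hY), Y_mul (hd hI) (hd hY)]
  have h1 : X (fun _ : R3 => Complex.I) p = 0 := by simp [X]
  have h2 : Y k (fun _ : R3 => Complex.I) p = 0 := by simp [Y]
  simp only [L, XY, h1, h2]
  linear_combination (-Y k (Y k u) p) * Complex.I_sq

/-- The model functions are solutions of `Lt u = 0` when `a` is constant equal to `2 m + 1`. -/
lemma Lt_model (hk : Odd k) (hkm : k = 1 ∨ m = 0) (p : R3) : Lt k a (model k r m N) p =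
    ((2 * m + 1 - a p.1) * (k * p.1 ^ (k - 1)) * N * r ^ (k + 1) : ℝ) *
      (zbar r p ^ m * (zeta k r p)⁻¹ ^ (N + 1)) := by
  -- `X + iY` kills `zeta` and multiplies `zbar ^ m` down to `2 m r zbar ^ (m - 1)`. For `m = 0` the
  -- coefficient vanishes, so the truncated `m - 1` is harmless.
  have hh : (fun q => X (model k r m N) q + Complex.I * Y k (model k r m N) q) =
      fun q => (2 * m * r : ℂ) * model k r (m - 1) N q := by
    funext q
    rw [X_model hk, Y_model hk, model]
    linear_combination (-(m * r * zbar r q ^ (m - 1) * (zeta k r q)⁻¹ ^ N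
      + N * zbar r q ^ m * (zeta k r q)⁻¹ ^ (N + 1) * Xzeta k r q)) * Complex.I_sq
  have hd : ∀ {w : R3 → ℂ}, ContDiff ℝ ∞ w → Differentiable ℝ w := fun hw =>
    hw.differentiable (by simp)
  have hc : ContDiff ℝ ∞ (fun _ : R3 => (2 * m * r : ℂ)) := contDiff_const
  have h1 : X (fun _ : R3 => (2 * m * r : ℂ)) p = 0 := by simp [X]
  have h2 : Y k (fun _ : R3 => (2 * m * r : ℂ)) p = 0 := by simp [Y]
  rw [Lt, L_eq_factored (contDiff_model hk), hh, X_mul (hd hc) (hd (contDiff_model hk)),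
    Y_mul (hd hc) (hd (contDiff_model hk)), XY_eq (contDiff_model hk), T_model hk]
  simp only [h1, h2, X_model hk, Y_model hk]
  -- For `k = 1`, `(X - iY) zeta = r zbar` restores the lost factor `zbar`, and the factored term
  -- has the same shape as the commutator term. For `m = 0` only the commutator term remains.
  rcases hkm with rfl | rfl
  · have hD : Xzeta 1 r p = r * zbar r p / 2 := by
      rw [Xzeta, zbar]
      ring
    rw [hD]
    rcases m with _ | m
    · push_cast
      linear_combination (-((N : ℂ) * r ^ 2 * (1 - a p.1) * (zeta 1 r p)⁻¹ ^ (N + 1))) * Complex.I_sq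
    · simp only [Nat.add_sub_cancel]
      push_cast
      linear_combination ((r : ℂ) ^ 2 * N * zbar r p ^ (m + 1) * (zeta 1 r p)⁻¹ ^ (N + 1) *
        (a p.1 - 2 - m) - 2 * (m + 1) * m * (r : ℂ) ^ 2 * zbar r p ^ (m - 1) *
        (zeta 1 r p)⁻¹ ^ N) * Complex.I_sq
  · push_cast
    linear_combination ((r : ℂ) ^ (k + 1) * (zeta k r p)⁻¹ ^ (N + 1) * N * k * p.1 ^ (k - 1) *
      (a p.1 - 1)) * Complex.I_sq

end Model

/-! ### Third-order vanishing of the coefficient. -/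

lemma abs_le_of_abs_deriv_le {f : ℝ → ℝ} (hf : Differentiable ℝ f) (h0 : f 0 = 0) {M : ℝ}
    {n : ℕ} (h : ∀ x, |x| ≤ 1 → |deriv f x| ≤ M * |x| ^ n) (hM : 0 ≤ M) (x : ℝ) (hx : |x| ≤ 1) :
    |f x| ≤ M * |x| ^ (n + 1) := by
  have hs : Convex ℝ (Set.Icc (-|x|) |x|) := convex_Icc _ _
  have h1 := hs.norm_image_sub_le_of_norm_deriv_le (f := f) (x := 0) (y := x) (C := M * |x| ^ n)
    (fun y _ => hf y) (fun y hy => by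
      have hy' : |y| ≤ |x| := abs_le.2 hy
      exact (h y (hy'.trans hx)).trans (by gcongr)) (by simp) ⟨neg_abs_le x, le_abs_self x⟩
  simp only [h0, sub_zero, Real.norm_eq_abs] at h1
  rw [pow_succ, ← mul_assoc]
  exact h1

/-- The third derivative is bounded on `[-1, 1]`; three applications of the mean value inequality
from `0` gain one power of `|x|` each. -/
lemma exists_abs_sub_le_cube {a : ℝ → ℝ} (ha : ContDiff ℝ ∞ a) (h1 : iteratedDeriv 1 a 0 = 0)
    (h2 : iteratedDeriv 2 a 0 = 0) : ∃ M, 0 ≤ M ∧ ∀ x, |x| ≤ 1 → |a x - a 0| ≤ M * |x| ^ 3 := by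
  have d1 : ContDiff ℝ ∞ (deriv a) := ContDiff.deriv' (n := ∞) (by simpa using ha)
  have d2 : ContDiff ℝ ∞ (deriv (deriv a)) := ContDiff.deriv' (n := ∞) (by simpa using d1)
  have d3 : ContDiff ℝ ∞ (deriv (deriv (deriv a))) := ContDiff.deriv' (n := ∞) (by simpa using d2)
  obtain ⟨M, hM⟩ := (isCompact_Icc (a := (-1 : ℝ)) (b := 1)).exists_bound_of_continuousOn
    d3.continuous.continuousOn
  have hM0 : 0 ≤ M := (norm_nonneg _).trans (hM 0 (by simp))
  have hd : ∀ {f : ℝ → ℝ}, ContDiff ℝ ∞ f → Differentiable ℝ f := fun hf =>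
    hf.differentiable (by simp)
  have e1 : deriv a 0 = 0 := by simpa using h1
  have e2 : deriv (deriv a) 0 = 0 := by simpa [iteratedDeriv_succ] using h2
  have b2 := abs_le_of_abs_deriv_le (hd d2) e2 (M := M) (n := 0)
    (fun x hx => by simpa using hM x (abs_le.1 hx)) hM0
  have b1 := abs_le_of_abs_deriv_le (hd d1) e1 b2 hM0
  have b0 := abs_le_of_abs_deriv_le (f := fun x => a x - a 0) ((hd ha).sub_const _) (by simp)
    (fun x hx => by simpa only [deriv_sub_const] using b1 x hx) hM0
  exact ⟨M, hM0, b0⟩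

lemma two_mul_pow_mul_inv_pow {s : ℝ} (hs : s ≠ 0) (n j : ℕ) :
    (2 * s) ^ n * s⁻¹ ^ (n + j) = 2 ^ n * s⁻¹ ^ j := by
  rw [mul_pow, pow_add, mul_assoc, ← mul_assoc (s ^ n), ← mul_pow, mul_inv_cancel₀ hs, one_pow,
    one_mul]

/-! ### Pointwise bounds, uniform in the dilation parameter. -/

section Bounds

variable {k : ℕ} {r : ℝ} {m N : ℕ} {a : ℝ → ℝ}

lemma norm_zbar_sq (p : R3) : ‖zbar r p‖ ^ 2 = (r * p.1) ^ 2 + (r * p.2.1) ^ 2 := by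
  have : zbar r p = ((r * p.1 : ℝ) : ℂ) + ((-(r * p.2.1) : ℝ) : ℂ) * Complex.I := by
    rw [zbar]
    push_cast
    ring
  rw [this, ← Complex.normSq_eq_norm_sq, Complex.normSq_add_mul_I]
  ring

lemma norm_zbar_le (hk : Odd k) (p : R3) : ‖zbar r p‖ ≤ 2 * ‖zeta k r p‖ := by
  have h1 := norm_zeta_ge (r := r) hk p
  have h2 := one_le_norm_zeta (r := r) hk p
  refine abs_le_of_sq_le_sq' ?_ (by positivity) |>.2
  rw [norm_zbar_sq]
  nlinarith

lemma abs_x_le (hk : Odd k) (p : R3) : |r * p.1| ≤ 2 * ‖zeta k r p‖ := by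
  refine le_trans (abs_le_of_sq_le_sq ?_ (norm_nonneg _)) (norm_zbar_le hk p)
  rw [norm_zbar_sq]
  nlinarith [sq_nonneg (r * p.2.1)]

lemma norm_Xzeta_le (hk : Odd k) (hr : 0 ≤ r) (p : R3) :
    ‖Xzeta k r p‖ ≤ r * (2 * (2 * ‖zeta k r p‖) ^ k) := by
  have hs := one_le_norm_zeta (r := r) hk p
  have e : Xzeta k r p = ((r * (r * p.1) ^ k : ℝ) : ℂ) - r * ((starRingEnd ℂ) (zbar r p)) / 2 := by
    simp only [Xzeta, zbar, map_mul, map_sub, Complex.conj_ofReal, Complex.conj_I]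
    push_cast
    ring
  rw [e]
  refine (norm_sub_le _ _).trans ?_
  simp only [Complex.norm_real, norm_div, norm_mul, RCLike.norm_conj, norm_pow, Real.norm_eq_abs,
    abs_of_nonneg hr, Complex.norm_ofNat]
  rw [show r * |p.1| = |r * p.1| by rw [abs_mul, abs_of_nonneg hr]]
  have h1 : |r * p.1| ^ k ≤ (2 * ‖zeta k r p‖) ^ k := by
    gcongr
    exact abs_x_le hk p
  have h2 : 2 * ‖zeta k r p‖ ≤ (2 * ‖zeta k r p‖) ^ k :=
    le_self_pow₀ (by linarith) hk.pos.ne'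
  have h3 := norm_zbar_le (r := r) hk p
  have h4 : |r * p.1| ^ k + ‖zbar r p‖ / 2 ≤ 2 * (2 * ‖zeta k r p‖) ^ k := by linarith
  calc r * |r * p.1| ^ k + r * ‖zbar r p‖ / 2 = r * (|r * p.1| ^ k + ‖zbar r p‖ / 2) := by ring
    _ ≤ _ := by gcongr

/-- The polynomial factors in the model and its first derivatives grow at most like `‖zeta‖ ^ (m +
k)`, so the exponent `m + k + 3` leaves three inverse powers: one pays for the cutoff, the other two
make the square integrable. -/
lemma norm_model_le (hk : Odd k) (p : R3) :
    ‖model k r m (m + k + 3) p‖ ≤ 2 ^ (m + k) * ‖zeta k r p‖⁻¹ ^ 3 := by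
  have hs := one_le_norm_zeta (r := r) hk p
  rw [model, norm_mul, norm_pow, norm_pow, norm_inv]
  set s := ‖zeta k r p‖
  have hs0 : s ≠ 0 := by positivity
  calc ‖zbar r p‖ ^ m * s⁻¹ ^ (m + k + 3) ≤ (2 * s) ^ (m + k) * s⁻¹ ^ (m + k + 3) := by
        gcongr
        exact (pow_le_pow_left₀ (norm_nonneg _) (norm_zbar_le hk p) m).trans
          (pow_le_pow_right₀ (by linarith) (by omega))
    _ = 2 ^ (m + k) * s⁻¹ ^ 3 := two_mul_pow_mul_inv_pow hs0 _ _

/-- Up to sign and a factor of modulus one, `X` and `Y` of the model are combinations of the same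
two terms; bounding the sum of their norms serves both. -/
lemma norm_model_deriv_le (hk : Odd k) (hr : 0 ≤ r) (p : R3) :
    ‖(m * r * zbar r p ^ (m - 1) * (zeta k r p)⁻¹ ^ (m + k + 3) : ℂ)‖ +
      ‖(↑(m + k + 3 : ℕ) * zbar r p ^ m * (zeta k r p)⁻¹ ^ (m + k + 3 + 1) * Xzeta k r p : ℂ)‖ ≤
    r * ((m + 2 * (m + k + 3)) * 2 ^ (m + k) * ‖zeta k r p‖⁻¹ ^ 3) := by
  have hs := one_le_norm_zeta (r := r) hk p
  have hX := norm_Xzeta_le hk hr p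
  have hz := norm_zbar_le (r := r) hk p
  simp only [norm_mul, norm_pow, norm_inv, Complex.norm_natCast, Complex.norm_real,
    Real.norm_eq_abs, abs_of_nonneg hr]
  set s := ‖zeta k r p‖
  have hs0 : s ≠ 0 := by positivity
  have e : (2 * s) ^ (m + k) * s⁻¹ ^ (m + k + 3) = 2 ^ (m + k) * s⁻¹ ^ 3 :=
    two_mul_pow_mul_inv_pow hs0 _ _
  have b1 : ‖zbar r p‖ ^ (m - 1) ≤ (2 * s) ^ (m + k) :=
    (pow_le_pow_left₀ (norm_nonneg _) hz _).trans (pow_le_pow_right₀ (by linarith) (by omega))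
  have b2 : ‖zbar r p‖ ^ m ≤ (2 * s) ^ m := pow_le_pow_left₀ (norm_nonneg _) hz _
  have b3 : s⁻¹ ^ (m + k + 3 + 1) ≤ s⁻¹ ^ (m + k + 3) :=
    pow_le_pow_of_le_one (by positivity) (inv_le_one_of_one_le₀ hs) (by omega)
  calc _ ≤ m * r * (2 * s) ^ (m + k) * s⁻¹ ^ (m + k + 3) +
        ((m + k + 3 : ℕ) : ℝ) * (2 * s) ^ m * s⁻¹ ^ (m + k + 3) * (r * (2 * (2 * s) ^ k)) := by
        gcongr
    _ = r * ((m + 2 * (m + k + 3)) * ((2 * s) ^ (m + k) * s⁻¹ ^ (m + k + 3))) := by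
        rw [pow_add (2 * s)]
        push_cast
        ring
    _ = _ := by rw [e]; ring

lemma norm_X_model_le (hk : Odd k) (hr : 0 ≤ r) (p : R3) : ‖X (model k r m (m + k + 3)) p‖ ≤
    r * ((m + 2 * (m + k + 3)) * 2 ^ (m + k) * ‖zeta k r p‖⁻¹ ^ 3) := by
  rw [X_model hk]
  exact (norm_sub_le _ _).trans (norm_model_deriv_le hk hr p)

lemma norm_Y_model_le (hk : Odd k) (hr : 0 ≤ r) (p : R3) : ‖Y k (model k r m (m + k + 3)) p‖ ≤
    r * ((m + 2 * (m + k + 3)) * 2 ^ (m + k) * ‖zeta k r p‖⁻¹ ^ 3) := by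
  rw [Y_model hk, norm_mul, norm_neg, Complex.norm_I, one_mul]
  exact (norm_add_le _ _).trans (norm_model_deriv_le hk hr p)

/-- By homogeneity `|x| ^ 3 * |x| ^ (k - 1) * r ^ (k + 1) = |r x| ^ (k + 2) / r`. The factor `1 / r`
is the whole gain; with only `|x| ^ 2` there would be none. -/
lemma norm_Lt_model_le (hk : Odd k) (hkm : k = 1 ∨ m = 0) (hr : 0 < r) {M : ℝ} {p : R3}
    (hM0 : 0 ≤ M) (hM : |2 * m + 1 - a p.1| ≤ M * |p.1| ^ 3) :
    ‖Lt k a (model k r m (m + k + 3)) p‖ ≤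
      M * k * (m + k + 3) * 2 ^ (m + k + 2) / r * ‖zeta k r p‖⁻¹ ^ 2 := by
  have hs := one_le_norm_zeta (r := r) hk p
  have hz := norm_zbar_le (r := r) hk p
  have hx := abs_x_le (r := r) hk p
  rw [Lt_model hk hkm, norm_mul, norm_mul, norm_pow, norm_pow, norm_inv, Complex.norm_real]
  simp only [norm_mul, norm_pow, Real.norm_eq_abs, abs_of_pos hr, Nat.abs_cast]
  set s := ‖zeta k r p‖
  have hs0 : s ≠ 0 := by positivity
  have hk1 := hk.pos
  have e1 : |p.1| ^ 3 * |p.1| ^ (k - 1) * r ^ (k + 1) = |r * p.1| ^ (k + 2) / r := by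
    rw [abs_mul, abs_of_pos hr, ← pow_add, show 3 + (k - 1) = k + 2 by omega]
    field_simp
    ring
  calc _ ≤ (M * |p.1| ^ 3) * (k * |p.1| ^ (k - 1)) * ((m + k + 3 : ℕ) : ℝ) * r ^ (k + 1) *
        ((2 * s) ^ m * s⁻¹ ^ (m + k + 3 + 1)) := by gcongr
    _ = M * (k * (m + k + 3) / r) * (|r * p.1| ^ (k + 2) * ((2 * s) ^ m * s⁻¹ ^ (m + k + 3 + 1))) := by
        push_cast
        linear_combination (M * k * (m + k + 3) * ((2 * s) ^ m * s⁻¹ ^ (m + k + 3 + 1))) * e1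
    _ ≤ M * (k * (m + k + 3) / r) * ((2 * s) ^ (k + 2) * ((2 * s) ^ m * s⁻¹ ^ (m + k + 3 + 1))) := by
        gcongr
    _ = _ := by
        rw [← mul_assoc ((2 * s) ^ (k + 2)), ← pow_add, show k + 2 + m = m + k + 2 by ring,
          show m + k + 3 + 1 = (m + k + 2) + 2 by ring, two_mul_pow_mul_inv_pow hs0]
        ring

/-- `‖zeta‖` controls `(r x) ^ 2`, `(r y) ^ 2` and `|r ^ (k + 1) t|`. One power pays for `x`, one
for `y`, two for `t`, each with constant `5`. -/
lemma inv_pow_four_le (hk : Odd k) (p : R3) : ‖zeta k r p‖⁻¹ ^ 4 ≤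
    125 * ((1 + (r * p.1) ^ 2)⁻¹ * ((1 + (r * p.2.1) ^ 2)⁻¹ *
      (1 + (r ^ (k + 1) * p.2.2) ^ 2)⁻¹)) := by
  have hs := one_le_norm_zeta (r := r) hk p
  have h1 := norm_zeta_ge (r := r) hk p
  have h2 := sq_le_sq.2 ((abs_t_le (r := r) hk p).trans (le_abs_self _))
  set s := ‖zeta k r p‖
  have b1 : 1 + (r * p.1) ^ 2 ≤ 5 * s := by nlinarith [sq_nonneg (r * p.2.1)]
  have b2 : 1 + (r * p.2.1) ^ 2 ≤ 5 * s := by nlinarith [sq_nonneg (r * p.1)]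
  have b3 : 1 + (r ^ (k + 1) * p.2.2) ^ 2 ≤ 5 * s ^ 2 := by nlinarith
  rw [← mul_inv, ← mul_inv, inv_pow, ← div_eq_mul_inv, inv_eq_one_div,
    div_le_div_iff₀ (by positivity) (by positivity), one_mul]
  calc _ ≤ (5 * s) * ((5 * s) * (5 * s ^ 2)) := by gcongr
    _ = _ := by ring

/-- Away from the origin one coordinate is at least `σ`; in the direction `t` this uses `r ^ (k + 1)
≥ r ^ 2`. -/
lemma sq_le_norm_zeta (hk : Odd k) (hr : 1 ≤ r) {σ : ℝ} (hσ : 0 ≤ σ) (hσ1 : σ ≤ 1) {p : R3}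
    (hp : σ ≤ ‖p‖) : r ^ 2 * σ ^ 2 ≤ 4 * ‖zeta k r p‖ := by
  have h1 := norm_zeta_ge (r := r) hk p
  have h2 := abs_t_le (r := r) hk p
  have hs := one_le_norm_zeta (r := r) hk p
  have key : ∀ x : ℝ, σ ≤ ‖x‖ → r ^ 2 * σ ^ 2 ≤ (r * x) ^ 2 := fun x hx => by
    rw [mul_pow, ← sq_abs x]
    gcongr
    exact hx
  rw [Prod.norm_def, Prod.norm_def, le_max_iff, le_max_iff] at hp
  rcases hp with hp | hp | hp
  · nlinarith [key _ hp, sq_nonneg (r * p.2.1)]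
  · nlinarith [key _ hp, sq_nonneg (r * p.1)]
  · have h3 : r ^ 2 ≤ r ^ (k + 1) := pow_le_pow_right₀ hr (by have := hk.pos; omega)
    rw [abs_mul, abs_of_nonneg (by positivity)] at h2
    have h4 : r ^ 2 * σ ≤ r ^ (k + 1) * |p.2.2| := by
      gcongr
      exact hp
    have h5 : r ^ 2 * σ ^ 2 ≤ r ^ 2 * σ := by
      gcongr
      nlinarith
    linarith

end Bounds

/-! ### Cutoff, comparison of norms, and proof of part (1). -/

section Quasimodes

variable {k : ℕ} {r : ℝ} {m : ℕ} {a : ℝ → ℝ}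

lemma exists_norm_le_of_hasCompactSupport {u : R3 → ℂ} (hu : Continuous u)
    (hc : HasCompactSupport u) : ∃ C, ∀ p, ‖u p‖ ≤ C :=
  hu.bounded_above_of_compact_support hc

lemma X_L_eq_zero_of_eventuallyEq_one {χ : R3 → ℂ} {p : R3} (h : χ =ᶠ[nhds p] fun _ => 1) :
    X χ p = 0 ∧ Y k χ p = 0 ∧ L k a χ p = 0 := by
  have hf : fderiv ℝ χ =ᶠ[nhds p] fun _ => 0 := by
    filter_upwards [h.eventuallyEq_nhds] with q hq
    rw [hq.fderiv_eq, fderiv_fun_const]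
    rfl
  have hX : X χ =ᶠ[nhds p] fun _ => 0 := hf.mono fun q hq => by simp [X, hq]
  have hY : Y k χ =ᶠ[nhds p] fun _ => 0 := hf.mono fun q hq => by simp [Y, hq]
  have hX' : fderiv ℝ (X χ) p = 0 := by rw [hX.fderiv_eq, fderiv_fun_const]; rfl
  have hY' : fderiv ℝ (Y k χ) p = 0 := by rw [hY.fderiv_eq, fderiv_fun_const]; rfl
  refine ⟨hX.eq_of_nhds, hY.eq_of_nhds, ?_⟩
  change -fderiv ℝ (X χ) p _ - fderiv ℝ (Y k χ) p _ +
    _ * (fderiv ℝ (Y k χ) p _ - fderiv ℝ (X χ) p _) = 0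
  simp [hX', hY']

/-- In the Leibniz expansion the term with `χ` undifferentiated is `O(1 / r)` by homogeneity. The
others live outside the ball of radius `σ`: a derivative of the model costs `r`, but a spare
`‖zeta‖⁻¹` gains `r ^ (-2)` there. -/
lemma exists_norm_Lt_cutoff_mul_model_le (ha : ContDiff ℝ ∞ a) (hk : Odd k) (hkm : k = 1 ∨ m = 0)
    {M : ℝ} (hM0 : 0 ≤ M) (hM : ∀ x, |x| ≤ 1 → |2 * m + 1 - a x| ≤ M * |x| ^ 3)
    {χ : R3 → ℂ} (hχ : ContDiff ℝ ∞ χ) (hχc : HasCompactSupport χ) (hχ1 : ∀ p, ‖χ p‖ ≤ 1)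
    (hχs : ∀ p, 1 < ‖p‖ → χ p = 0) {σ : ℝ} (hσ0 : 0 < σ) (hσ1 : σ ≤ 1)
    (hχσ : ∀ p, ‖p‖ < σ → χ p = 1) :
    ∃ C, 0 ≤ C ∧ ∀ r, 1 ≤ r → ∀ p, ‖Lt k a (fun q => χ q * model k r m (m + k + 3) q) p‖ ≤
      C / r * ‖zeta k r p‖⁻¹ ^ 2 := by
  obtain ⟨K₁, hK₁⟩ := exists_norm_le_of_hasCompactSupport (contDiff_X hχ).continuous
    (hasCompactSupport_X hχc)
  obtain ⟨K₂, hK₂⟩ := exists_norm_le_of_hasCompactSupport (contDiff_Y (k := k) hχ).continuous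
    (hasCompactSupport_Y hχc)
  obtain ⟨K₃, hK₃⟩ := exists_norm_le_of_hasCompactSupport
    (contDiff_L (k := k) ha.neg hχ).continuous (hasCompactSupport_L hχc)
  have hK₁0 : 0 ≤ K₁ := (norm_nonneg _).trans (hK₁ 0)
  have hK₂0 : 0 ≤ K₂ := (norm_nonneg _).trans (hK₂ 0)
  have hK₃0 : 0 ≤ K₃ := (norm_nonneg _).trans (hK₃ 0)
  set A : ℝ := (m + 2 * (m + k + 3)) * 2 ^ (m + k) with hA
  set B : ℝ := M * k * (m + k + 3) * 2 ^ (m + k + 2) with hB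
  have hA0 : 0 ≤ A := by positivity
  have hB0 : 0 ≤ B := by positivity
  -- This lets the term with the undifferentiated model share the bound of the first-order terms.
  have hA1 : 2 ^ (m + k) ≤ A := by
    rw [hA]
    refine le_mul_of_one_le_left (by positivity) ?_
    have : (0 : ℝ) ≤ m := by positivity
    have : (0 : ℝ) ≤ k := by positivity
    linarith
  refine ⟨B + (2 * K₁ + 2 * K₂ + K₃) * A * (4 / σ ^ 2), by positivity, fun r hr p => ?_⟩
  have hr0 : 0 < r := by linarith
  have hs := one_le_norm_zeta (r := r) hk p
  have main : ‖χ p * Lt k a (model k r m (m + k + 3)) p‖ ≤ B / r * ‖zeta k r p‖⁻¹ ^ 2 := by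
    by_cases hp : 1 < ‖p‖
    · rw [hχs p hp, zero_mul, norm_zero]
      positivity
    · rw [norm_mul]
      refine (mul_le_of_le_one_left (norm_nonneg _) (hχ1 p)).trans ?_
      refine norm_Lt_model_le hk hkm hr0 hM0 (hM p.1 ?_)
      exact (norm_fst_le p).trans (not_lt.1 hp)
  have hL := L_mul (k := k) (a := fun x => -a x) hχ (contDiff_model (r := r) (m := m)
    (N := m + k + 3) hk) p
  change Lt k a _ p = χ p * Lt k a _ p - _ - _ + _ at hL
  rw [hL]
  by_cases hp : ‖p‖ < σ
  · have hev : χ =ᶠ[nhds p] fun _ => 1 := by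
      filter_upwards [(isOpen_lt continuous_norm continuous_const).mem_nhds hp] with q hq
      exact hχσ q hq
    obtain ⟨h1, h2, h3⟩ := X_L_eq_zero_of_eventuallyEq_one (k := k) (a := fun x => -a x) hev
    rw [h1, h2, h3]
    simp only [zero_mul, mul_zero, sub_zero, add_zero]
    refine main.trans ?_
    gcongr
    have : 0 ≤ (2 * K₁ + 2 * K₂ + K₃) * A * (4 / σ ^ 2) := by positivity
    linarith
  · have h4 := sq_le_norm_zeta hk hr hσ0.le hσ1 (not_lt.1 hp)
    have bX := norm_X_model_le (m := m) hk hr0.le p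
    have bY := norm_Y_model_le (m := m) hk hr0.le p
    have b0 := norm_model_le (r := r) (m := m) hk p
    rw [← hA] at bX bY
    set s := ‖zeta k r p‖
    have hs0 : 0 < s := by linarith
    have b0' : ‖model k r m (m + k + 3) p‖ ≤ r * (A * s⁻¹ ^ 3) :=
      b0.trans ((mul_le_mul_of_nonneg_right hA1 (by positivity)).trans
        (le_mul_of_one_le_left (by positivity) hr))
    have e : r * (A * s⁻¹ ^ 3) ≤ A * (4 / σ ^ 2) / r * s⁻¹ ^ 2 := by
      have h5 : r * s⁻¹ ≤ 4 / σ ^ 2 / r := by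
        rw [div_div, le_div_iff₀ (by positivity), ← div_eq_mul_inv, div_mul_eq_mul_div,
          div_le_iff₀ hs0]
        nlinarith
      calc r * (A * s⁻¹ ^ 3) = A * (r * s⁻¹) * s⁻¹ ^ 2 := by ring
        _ ≤ A * (4 / σ ^ 2 / r) * s⁻¹ ^ 2 := by gcongr
        _ = _ := by ring
    calc _ ≤ ‖χ p * Lt k a (model k r m (m + k + 3)) p‖ +
          2 * (‖X χ p‖ * ‖X (model k r m (m + k + 3)) p‖) +
          2 * (‖Y k χ p‖ * ‖Y k (model k r m (m + k + 3)) p‖) +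
          ‖Lt k a χ p‖ * ‖model k r m (m + k + 3) p‖ := by
          refine (norm_add_le _ _).trans (add_le_add ((norm_sub_le _ _).trans
            (add_le_add ((norm_sub_le _ _).trans (add_le_add le_rfl ?_)) ?_)) ?_)
          · simp
          · simp
          · rw [norm_mul]; rfl
      _ ≤ B / r * s⁻¹ ^ 2 + 2 * (K₁ * (A * (4 / σ ^ 2) / r * s⁻¹ ^ 2)) +
          2 * (K₂ * (A * (4 / σ ^ 2) / r * s⁻¹ ^ 2)) + K₃ * (A * (4 / σ ^ 2) / r * s⁻¹ ^ 2) := by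
          gcongr
          · exact hK₁ p
          · exact bX.trans e
          · exact hK₂ p
          · exact bY.trans e
          · exact hK₃ p
          · exact b0'.trans e
      _ = _ := by ring

lemma integrable_inv_one_add_mul_sq {b : ℝ} (hb : 0 < b) :
    Integrable (fun x : ℝ => (1 + (b * x) ^ 2)⁻¹) :=
  integrable_inv_one_add_sq.comp_mul_left' hb.ne'

lemma integral_inv_one_add_mul_sq {b : ℝ} (hb : 0 < b) :
    ∫ x : ℝ, (1 + (b * x) ^ 2)⁻¹ = b⁻¹ * Real.pi := by
  have := Measure.integral_comp_mul_left (fun x : ℝ => (1 + x ^ 2)⁻¹) b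
  rw [integral_univ_inv_one_add_sq, abs_of_pos (inv_pos.2 hb)] at this
  simpa using this

lemma integrable_weight (hr : 0 < r) : Integrable (fun p : R3 => (1 + (r * p.1) ^ 2)⁻¹ *
    ((1 + (r * p.2.1) ^ 2)⁻¹ * (1 + (r ^ (k + 1) * p.2.2) ^ 2)⁻¹)) :=
  (integrable_inv_one_add_mul_sq hr).mul_prod ((integrable_inv_one_add_mul_sq hr).mul_prod
    (integrable_inv_one_add_mul_sq (pow_pos hr (k + 1))))

lemma integral_weight (hr : 0 < r) : ∫ p : R3, (1 + (r * p.1) ^ 2)⁻¹ *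
    ((1 + (r * p.2.1) ^ 2)⁻¹ * (1 + (r ^ (k + 1) * p.2.2) ^ 2)⁻¹) =
      (r * r * r ^ (k + 1))⁻¹ * Real.pi ^ 3 := by
  have h1 := integral_prod_mul (μ := (volume : Measure ℝ)) (ν := (volume : Measure ℝ))
    (fun x : ℝ => (1 + (r * x) ^ 2)⁻¹) (fun x : ℝ => (1 + (r ^ (k + 1) * x) ^ 2)⁻¹)
  have h2 := integral_prod_mul (μ := (volume : Measure ℝ)) (ν := (volume : Measure (ℝ × ℝ)))
    (fun x : ℝ => (1 + (r * x) ^ 2)⁻¹)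
    (fun q : ℝ × ℝ => (1 + (r * q.1) ^ 2)⁻¹ * (1 + (r ^ (k + 1) * q.2) ^ 2)⁻¹)
  rw [integral_inv_one_add_mul_sq hr] at h1 h2
  rw [integral_inv_one_add_mul_sq (pow_pos hr (k + 1))] at h1
  refine h2.trans ?_
  rw [show (∫ q : ℝ × ℝ, (1 + (r * q.1) ^ 2)⁻¹ * (1 + (r ^ (k + 1) * q.2) ^ 2)⁻¹) = _ from h1]
  rw [mul_inv, mul_inv]
  ring

/-- The box has fixed size in the dilated coordinates; `r x ≥ 1` keeps it away from the zeros of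
`zbar`. -/
lemma norm_model_ge (hk : Odd k) {N : ℕ} {p : R3} (hx : r * p.1 ∈ Set.Icc 1 2)
    (hy : r * p.2.1 ∈ Set.Icc 0 1) (ht : r ^ (k + 1) * p.2.2 ∈ Set.Icc 0 1) :
    ((6 + 2 ^ (k + 1) : ℝ)⁻¹) ^ N ≤ ‖model k r m N p‖ := by
  have hs := one_le_norm_zeta (r := r) hk p
  have hz : 1 ≤ ‖zbar r p‖ := by
    have h1 := norm_zbar_sq (r := r) p
    nlinarith [hx.1, sq_nonneg (r * p.2.1), norm_nonneg (zbar r p)]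
  have hζ : ‖zeta k r p‖ ≤ 6 + 2 ^ (k + 1) := by
    refine (Complex.norm_le_abs_re_add_abs_im _).trans ?_
    have h1 : (r * p.1) ^ (k + 1) / (k + 1) ≤ 2 ^ (k + 1) := by
      refine (div_le_self (pow_nonneg (by linarith [hx.1]) _) (by simp)).trans ?_
      exact pow_le_pow_left₀ (by linarith [hx.1]) hx.2 _
    have h1' : 0 ≤ (r * p.1) ^ (k + 1) / (k + 1) :=
      div_nonneg (pow_nonneg (by linarith [hx.1]) _) (by positivity)
    have h2 : |(zeta k r p).re| ≤ 4 + 2 ^ (k + 1) := by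
      rw [zeta_re, abs_le]
      obtain ⟨a1, a2⟩ := hx
      obtain ⟨b1, b2⟩ := hy
      constructor <;> nlinarith
    have h3 : |(zeta k r p).im| ≤ 2 := by
      rw [zeta_im, abs_le]
      obtain ⟨a1, a2⟩ := hx
      obtain ⟨b1, b2⟩ := hy
      obtain ⟨c1, c2⟩ := ht
      constructor <;> nlinarith
    linarith
  rw [model, norm_mul, norm_pow, norm_pow, norm_inv]
  calc ((6 + 2 ^ (k + 1) : ℝ)⁻¹) ^ N ≤ 1 * ‖zeta k r p‖⁻¹ ^ N := by
        rw [one_mul]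
        gcongr
    _ ≤ _ := by
        gcongr
        exact one_le_pow₀ hz

lemma integral_norm_cutoff_mul_model_ge (hk : Odd k) {χ : R3 → ℂ} (hχ : ContDiff ℝ ∞ χ)
    (hχc : HasCompactSupport χ) {σ : ℝ} (hχσ : ∀ p, ‖p‖ < σ → χ p = 1) (hr : 1 ≤ r)
    (hrσ : 2 / r < σ) {N : ℕ} :
    (((6 + 2 ^ (k + 1) : ℝ)⁻¹) ^ N) ^ 2 * (r * r * r ^ (k + 1))⁻¹ ≤
      ∫ p, ‖χ p * model k r m N p‖ ^ 2 := by
  have hr0 : 0 < r := by linarith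
  have hrk : 0 < r ^ (k + 1) := by positivity
  -- The condition `2 / r < σ` puts this box where `χ = 1`. Its volume scales in `r` exactly like
  -- the integral of the weight, so these powers cancel in the final quotient.
  set S : Set R3 := Set.Icc (1 / r) (2 / r) ×ˢ Set.Icc 0 (1 / r) ×ˢ Set.Icc 0 (1 / r ^ (k + 1))
    with hS
  have hSm : MeasurableSet S := measurableSet_Icc.prod (measurableSet_Icc.prod measurableSet_Icc)
  have hvol : volume S = ENNReal.ofReal ((r * r * r ^ (k + 1))⁻¹) := by
    have h1 : volume S = volume (Set.Icc (1 / r) (2 / r)) * (volume (Set.Icc 0 (1 / r)) *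
        volume (Set.Icc 0 (1 / r ^ (k + 1)))) := by
      rw [hS, Measure.volume_eq_prod, Measure.prod_prod, Measure.volume_eq_prod, Measure.prod_prod]
    rw [h1, Real.volume_Icc, Real.volume_Icc, Real.volume_Icc, sub_zero, sub_zero,
      ← ENNReal.ofReal_mul (by positivity), ← sub_div, ← ENNReal.ofReal_mul (by norm_num; positivity)]
    congr 1
    field_simp
    ring
  have hint : Integrable (fun p => ‖χ p * model k r m N p‖ ^ 2) := by
    refine Continuous.integrable_of_hasCompactSupport
      (((hχ.continuous.mul (contDiff_model hk).continuous).norm).pow 2) ?_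
    exact (hχc.mul_right (f' := model k r m N)).norm.comp_left (g := fun x : ℝ => x ^ 2) (by simp)
  refine le_trans ?_ (setIntegral_le_integral (s := S) hint
    (Filter.Eventually.of_forall fun p => by positivity))
  have h := setIntegral_ge_of_const_le (μ := volume) (s := S)
    (c := (((6 + 2 ^ (k + 1) : ℝ)⁻¹) ^ N) ^ 2) (f := fun p => ‖χ p * model k r m N p‖ ^ 2) hSm
    (by rw [hvol]; exact ENNReal.ofReal_ne_top) ?_ hint.integrableOn
  · rwa [Measure.real, hvol, ENNReal.toReal_ofReal (by positivity), smul_eq_mul, mul_comm] at h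
  · rintro ⟨x, y, t⟩ ⟨⟨x1, x2⟩, ⟨y1, y2⟩, ⟨t1, t2⟩⟩
    simp only at x1 x2 y1 y2 t1 t2
    have hlt : ‖((x, y, t) : R3)‖ < σ := by
      rw [Prod.norm_def, Prod.norm_def]
      have h1 : 1 / r ≤ 2 / r := by gcongr; norm_num
      have h0 : 0 < 1 / r := by positivity
      have h2 : 1 / r ^ (k + 1) ≤ 1 / r :=
        one_div_le_one_div_of_le hr0 (le_self_pow₀ hr (by omega))
      refine max_lt ?_ (max_lt ?_ ?_) <;> rw [Real.norm_eq_abs, abs_of_nonneg] <;>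
        simp only <;> linarith
    rw [hχσ _ hlt, one_mul]
    gcongr
    refine norm_model_ge hk ⟨?_, ?_⟩ ⟨?_, ?_⟩ ⟨?_, ?_⟩
    · rwa [div_le_iff₀' hr0] at x1
    · rwa [le_div_iff₀' hr0] at x2
    · positivity
    · rwa [le_div_iff₀' hr0] at y2
    · positivity
    · rwa [le_div_iff₀' hrk] at t2

/-- Concentrating solutions of the model equation violate any `L²` lower bound for `Lt`. -/
theorem exists_quasimode (ha : ContDiff ℝ ∞ a) (hk : Odd k) (hkm : k = 1 ∨ m = 0)
    (ha0 : a 0 = 2 * m + 1) (h1 : iteratedDeriv 1 a 0 = 0) (h2 : iteratedDeriv 2 a 0 = 0)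
    {ρ : ℝ} (hρ : 0 < ρ) {ε : ℝ} (hε : 0 < ε) :
    ∃ ψ : R3 → ℂ, ContDiff ℝ ∞ ψ ∧ HasCompactSupport ψ ∧
      tsupport ψ ⊆ Metric.closedBall 0 ρ ∧ 0 < ∫ p, ‖ψ p‖ ^ 2 ∧
      ∫ p, ‖Lt k a ψ p‖ ^ 2 ≤ ε * ∫ p, ‖ψ p‖ ^ 2 := by
  obtain ⟨M, hM0, hM⟩ := exists_abs_sub_le_cube ha h1 h2
  have hM' : ∀ x, |x| ≤ 1 → |2 * m + 1 - a x| ≤ M * |x| ^ 3 := fun x hx => by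
    rw [← ha0, abs_sub_comm]
    exact hM x hx
  -- Capped at `1` because the cubic bound on `a` is known only for `|x| ≤ 1`.
  set R : ℝ := min ρ 1 with hR
  have hR0 : 0 < R := lt_min hρ one_pos
  let b : ContDiffBump (0 : R3) := ⟨R / 2, R, by positivity, by linarith⟩
  set χ : R3 → ℂ := fun p => (b p : ℂ) with hχdef
  have hχ : ContDiff ℝ ∞ χ := Complex.ofRealCLM.contDiff.comp b.contDiff
  have hχt : tsupport χ ⊆ Metric.closedBall 0 R := by
    refine (closure_mono fun p hp => ?_).trans b.tsupport_eq.subset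
    contrapose! hp
    simp [hχdef, Function.notMem_support.1 hp]
  have hχc : HasCompactSupport χ :=
    (isCompact_closedBall (0 : R3) R).of_isClosed_subset (isClosed_tsupport _) hχt
  have hχ1 : ∀ p, ‖χ p‖ ≤ 1 := fun p => by
    simp only [hχdef, Complex.norm_real, Real.norm_eq_abs, abs_of_nonneg b.nonneg]
    exact b.le_one
  have hχs : ∀ p, 1 < ‖p‖ → χ p = 0 := fun p hp => by
    refine image_eq_zero_of_notMem_tsupport fun h => ?_
    have := mem_closedBall_zero_iff.1 (hχt h)
    linarith [min_le_right ρ 1]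
  have hχσ : ∀ p, ‖p‖ < R / 2 → χ p = 1 := fun p hp => by
    simp only [hχdef]
    rw [b.one_of_mem_closedBall (mem_closedBall_zero_iff.2 hp.le), Complex.ofReal_one]
  obtain ⟨C, hC0, hC⟩ := exists_norm_Lt_cutoff_mul_model_le ha hk hkm hM0 hM' hχ hχc hχ1 hχs
    (half_pos hR0) (by linarith [min_le_right ρ 1]) hχσ
  set c : ℝ := (((6 + 2 ^ (k + 1) : ℝ)⁻¹) ^ (m + k + 3)) ^ 2 with hc
  have hc0 : 0 < c := by positivity
  set D : ℝ := C ^ 2 * (125 * Real.pi ^ 3) with hD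
  have hD0 : 0 ≤ D := by positivity
  -- The second bound fits the box into the region `χ = 1`; the third makes `D / r ^ 2`, the ratio
  -- of the upper bound to the box volume, at most `ε * c`.
  obtain ⟨r, hr⟩ := exists_gt (max (max 1 (2 / (R / 2))) (D / (ε * c)))
  obtain ⟨⟨hr1, hr2⟩, hr3⟩ : (1 < r ∧ 2 / (R / 2) < r) ∧ D / (ε * c) < r := by
    simpa only [max_lt_iff] using hr
  have hr0 : 0 < r := by linarith
  have hlow := integral_norm_cutoff_mul_model_ge (m := m) hk hχ hχc hχσ hr1.le
    (by rwa [div_lt_comm₀ hr0 (half_pos hR0)]) (N := m + k + 3)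
  rw [← hc] at hlow
  have hE : 0 < (r * r * r ^ (k + 1))⁻¹ := by positivity
  refine ⟨fun p => χ p * model k r m (m + k + 3) p, hχ.mul (contDiff_model hk), hχc.mul_right,
    (tsupport_mul_subset_left.trans hχt).trans
      (Metric.closedBall_subset_closedBall (min_le_left _ _)), lt_of_lt_of_le (by positivity) hlow,
    ?_⟩
  calc ∫ p, ‖Lt k a (fun p => χ p * model k r m (m + k + 3) p) p‖ ^ 2
      ≤ ∫ p : R3, (C / r) ^ 2 * 125 * ((1 + (r * p.1) ^ 2)⁻¹ *
          ((1 + (r * p.2.1) ^ 2)⁻¹ * (1 + (r ^ (k + 1) * p.2.2) ^ 2)⁻¹)) := by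
        refine integral_mono_of_nonneg (Filter.Eventually.of_forall fun p => by positivity)
          ((integrable_weight hr0).const_mul _) (Filter.Eventually.of_forall fun p => ?_)
        calc ‖Lt k a (fun p => χ p * model k r m (m + k + 3) p) p‖ ^ 2
            ≤ (C / r * ‖zeta k r p‖⁻¹ ^ 2) ^ 2 := by
              gcongr
              exact hC r hr1.le p
          _ = (C / r) ^ 2 * ‖zeta k r p‖⁻¹ ^ 4 := by ring
          _ ≤ _ := by
              simp only [mul_assoc ((C / r) ^ 2)]
              gcongr
              exact inv_pow_four_le hk p
    _ = D / r ^ 2 * (r * r * r ^ (k + 1))⁻¹ := by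
        rw [integral_const_mul, integral_weight hr0]
        ring
    _ ≤ (ε * c) * (r * r * r ^ (k + 1))⁻¹ := by
        gcongr
        rw [div_lt_iff₀ (by positivity)] at hr3
        rw [div_le_iff₀ (by positivity)]
        have : ε * c * r ≤ ε * c * r ^ 2 := by
          gcongr
          nlinarith
        linarith
    _ ≤ _ := by
        rw [mul_assoc]
        gcongr

theorem not_locallySolvableL2 (ha : ContDiff ℝ ∞ a)
    (h : (k = 1 ∧ ∃ m : ℤ, Odd m ∧ a 0 = m) ∨ (1 < k ∧ Odd k ∧ (a 0 = 1 ∨ a 0 = -1)))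
    (h1 : iteratedDeriv 1 a 0 = 0) (h2 : iteratedDeriv 2 a 0 = 0) : ¬ LocallySolvableL2 k a := by
  have hk : Odd k := by
    rcases h with ⟨rfl, -⟩ | ⟨-, hk, -⟩
    exacts [odd_one, hk]
  obtain ⟨m, hkm, hm⟩ : ∃ m : ℕ, (k = 1 ∨ m = 0) ∧ (a 0 = 2 * m + 1 ∨ -a 0 = 2 * m + 1) := by
    rcases h with ⟨hk1, m, ⟨j, rfl⟩, hm⟩ | ⟨-, -, h0 | h0⟩
    · rcases le_or_gt 0 j with hj | hj
      · lift j to ℕ using hj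
        exact ⟨j, Or.inl hk1, Or.inl (by rw [hm]; push_cast; ring)⟩
      -- For `a 0 = 2 j + 1 < 0` one has `-a 0 = 2 (-j - 1) + 1`.
      · obtain ⟨i, hi⟩ := Int.eq_ofNat_of_zero_le (show 0 ≤ -j - 1 by omega)
        refine ⟨i, Or.inl hk1, Or.inr ?_⟩
        have hi' : (i : ℝ) = -j - 1 := by exact_mod_cast hi.symm
        rw [hm, hi']
        push_cast
        ring
    · exact ⟨0, Or.inr rfl, Or.inl (by simp [h0])⟩
    · exact ⟨0, Or.inr rfl, Or.inr (by simp [h0])⟩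
  refine not_locallySolvableL2_of_quasimodes ha fun ρ hρ ε hε => ?_
  rcases hm with hm | hm
  · exact exists_quasimode ha hk hkm hm h1 h2 hρ hε
  · obtain ⟨ψ, hψ, hψc, hψs, hψ0, hψL⟩ := exists_quasimode (a := fun x => -a x) ha.neg hk hkm hm
      (by rw [iteratedDeriv_fun_neg, h1, neg_zero]) (by rw [iteratedDeriv_fun_neg, h2, neg_zero])
      hρ hε
    have hsupp : tsupport (fun p => (starRingEnd ℂ) (ψ p)) ⊆ tsupport ψ := by
      refine closure_mono fun p hp => ?_
      contrapose! hp
      simp [Function.notMem_support.1 hp]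
    refine ⟨fun p => (starRingEnd ℂ) (ψ p), Complex.conjCLE.contDiff.comp hψ,
      hψc.of_isClosed_subset (isClosed_tsupport _) hsupp, hsupp.trans hψs, ?_, ?_⟩
    · simpa only [RCLike.norm_conj] using hψ0
    · simpa only [RCLike.norm_conj, Lt_conj] using hψL

end Quasimodes

/-! ### Test functions and the partial Fourier transform in `t`. -/

open scoped FourierTransform

/-- Smooth compactly supported functions. -/
def IsTest (u : R3 → ℂ) : Prop := ContDiff ℝ ∞ u ∧ HasCompactSupport u

section IsTest

variable {u v : R3 → ℂ} {k : ℕ} {a : ℝ → ℝ}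

lemma IsTest.X (hu : IsTest u) : IsTest (X u) := ⟨contDiff_X hu.1, hasCompactSupport_X hu.2⟩

lemma IsTest.Y (hu : IsTest u) : IsTest (Y k u) := ⟨contDiff_Y hu.1, hasCompactSupport_Y hu.2⟩

lemma IsTest.T (hu : IsTest u) : IsTest (T u) := ⟨contDiff_T hu.1, hasCompactSupport_T hu.2⟩

lemma IsTest.Lt (ha : ContDiff ℝ ∞ a) (hu : IsTest u) : IsTest (Lt k a u) :=
  ⟨contDiff_L ha.neg hu.1, hasCompactSupport_L hu.2⟩

lemma contDiff_coord {f : ℝ → ℝ} (hf : ContDiff ℝ ∞ f) :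
    ContDiff ℝ ∞ (fun p : R3 => (f p.1 : ℂ)) :=
  Complex.ofRealCLM.contDiff.comp (hf.comp contDiff_fst)

lemma IsTest.coord_mul {f : ℝ → ℝ} (hf : ContDiff ℝ ∞ f) (hu : IsTest u) :
    IsTest (fun p => (f p.1 : ℂ) * u p) :=
  ⟨(contDiff_coord hf).mul hu.1, hu.2.mul_left⟩

lemma IsTest.fderiv_apply (hu : IsTest u) (w : R3) : IsTest (fun p => fderiv ℝ u p w) :=
  ⟨(hu.1.fderiv_right (m := ∞) (by simp)).clm_apply contDiff_const, hu.2.fderiv_apply ℝ w⟩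

lemma IsTest.exists_bound (hu : IsTest u) : ∃ R, 0 ≤ R ∧ ∀ p : R3, R < ‖p‖ → u p = 0 := by
  obtain ⟨R, hR⟩ := hu.2.isCompact.isBounded.exists_norm_le
  refine ⟨max R 0, le_max_right _ _, fun p hp => image_eq_zero_of_notMem_tsupport fun h => ?_⟩
  exact absurd (hR p h) (not_le.2 ((le_max_left _ _).trans_lt hp))

lemma IsTest.contDiff_slice (hu : IsTest u) (q : ℝ × ℝ) :
    ContDiff ℝ ∞ (fun t => u (q.1, q.2, t)) :=
  hu.1.comp (contDiff_const.prodMk (contDiff_const.prodMk contDiff_id))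

lemma norm_slice_ge (q : ℝ × ℝ) (t : ℝ) : ‖t‖ ≤ ‖((q.1, q.2, t) : R3)‖ ∧
    ‖q‖ ≤ ‖((q.1, q.2, t) : R3)‖ := by
  simp only [Prod.norm_def]
  refine ⟨(le_max_right _ _).trans (le_max_right _ _), max_le (le_max_left _ _) ?_⟩
  exact (le_max_left _ _).trans (le_max_right _ _)

lemma IsTest.hasCompactSupport_slice (hu : IsTest u) (q : ℝ × ℝ) :
    HasCompactSupport (fun t => u (q.1, q.2, t)) := by
  obtain ⟨R, -, hR⟩ := hu.exists_bound
  refine HasCompactSupport.of_support_subset_isCompact (isCompact_closedBall (0 : ℝ) R) fun t ht => ?_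
  rw [mem_closedBall_zero_iff]
  by_contra h
  exact ht (hR _ ((not_le.1 h).trans_le (norm_slice_ge q t).1))

lemma IsTest.integrable_slice (hu : IsTest u) (q : ℝ × ℝ) :
    Integrable (fun t => u (q.1, q.2, t)) :=
  (hu.contDiff_slice q).continuous.integrable_of_hasCompactSupport (hu.hasCompactSupport_slice q)

end IsTest

/-- The partial Fourier transform with respect to `t`. -/
def pFourier (τ : ℝ) (u : R3 → ℂ) (q : ℝ × ℝ) : ℂ := 𝓕 (fun t => u (q.1, q.2, t)) τ

section pFourier

variable {u v w : R3 → ℂ} {τ : ℝ}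

lemma pFourier_eq (τ : ℝ) (u : R3 → ℂ) (q : ℝ × ℝ) :
    pFourier τ u q = ∫ t : ℝ, Complex.exp (((-2 * Real.pi * t * τ : ℝ) : ℂ) * Complex.I) *
      u (q.1, q.2, t) := by
  rw [pFourier, Real.fourier_real_eq_integral_exp_smul]
  simp

/-- Compact support reduces the integral to a fixed interval. Continuity is joint with `τ` because
Plancherel needs measurability in all variables. -/
lemma continuous_pFourier (hu : IsTest u) :
    Continuous (fun z : ℝ × ℝ × ℝ => pFourier z.1 u z.2) := by
  obtain ⟨R, -, hR⟩ := hu.exists_bound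
  have h : ∀ z : ℝ × ℝ × ℝ, pFourier z.1 u z.2 = ∫ t in Set.Icc (-R) R,
      Complex.exp (((-2 * Real.pi * t * z.1 : ℝ) : ℂ) * Complex.I) * u (z.2.1, z.2.2, t) := by
    intro z
    rw [pFourier_eq, setIntegral_eq_integral_of_forall_compl_eq_zero]
    intro t ht
    rw [hR, mul_zero]
    refine lt_of_lt_of_le ?_ (norm_slice_ge z.2 t).1
    rw [← not_le, Real.norm_eq_abs, abs_le]
    exact ht
  simp_rw [h]
  refine continuous_parametric_integral_of_continuous ?_ isCompact_Icc
  have := hu.1.continuous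
  simp only [Function.uncurry_def]
  fun_prop

lemma continuous_pFourier_right (hu : IsTest u) : Continuous (pFourier τ u) :=
  (continuous_pFourier hu).comp (continuous_const.prodMk continuous_id)

lemma hasCompactSupport_pFourier (hu : IsTest u) : HasCompactSupport (pFourier τ u) := by
  obtain ⟨R, -, hR⟩ := hu.exists_bound
  refine HasCompactSupport.of_support_subset_isCompact (isCompact_closedBall (0 : ℝ × ℝ) R)
    fun q hq => ?_
  rw [mem_closedBall_zero_iff]
  by_contra h
  refine hq ?_
  rw [pFourier_eq]
  simp_rw [hR _ ((not_le.1 h).trans_le (norm_slice_ge q _).2)]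
  simp

lemma hasFDerivAt_pFourier (hu : IsTest u) (q : ℝ × ℝ) :
    ∃ D : ℝ × ℝ →L[ℝ] ℂ, HasFDerivAt (pFourier τ u) D q ∧
      ∀ v : ℝ × ℝ, D v = pFourier τ (fun p => fderiv ℝ u p (v.1, v.2, 0)) q := by
  obtain ⟨R, -, hR⟩ := hu.exists_bound
  set e : ℝ → ℂ := fun t => Complex.exp (((-2 * Real.pi * t * τ : ℝ) : ℂ) * Complex.I) with he
  have hec : Continuous e := by fun_prop
  have hen : ∀ t, ‖e t‖ = 1 := fun t => Complex.norm_exp_ofReal_mul_I _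
  set ι : ℝ × ℝ →L[ℝ] R3 := (ContinuousLinearMap.fst ℝ ℝ ℝ).prod
    ((ContinuousLinearMap.snd ℝ ℝ ℝ).prod 0) with hι
  set F' : ℝ × ℝ → ℝ → ℝ × ℝ →L[ℝ] ℂ := fun q t => e t • (fderiv ℝ u (q.1, q.2, t)).comp ι with hF'
  have hdc : Continuous (fderiv ℝ u) := hu.1.continuous_fderiv (by simp)
  obtain ⟨K, hK⟩ := hdc.bounded_above_of_compact_support (hu.2.fderiv ℝ)
  have hK0 : 0 ≤ K := (norm_nonneg _).trans (hK 0)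
  have hF'c : Continuous (F' q) := by
    refine hec.smul ((hdc.comp ?_).clm_comp continuous_const)
    fun_prop
  have hzero : ∀ p : R3, R < ‖p‖ → fderiv ℝ u p = 0 := fun p hp => by
    have : u =ᶠ[nhds p] fun _ => 0 := by
      filter_upwards [(isOpen_lt continuous_const continuous_norm).mem_nhds hp] with z hz
      exact hR z hz
    rw [this.fderiv_eq, fderiv_fun_const]
    rfl
  -- The phase has modulus one and `u` has compact support, so a constant on `[-R, R]` dominates.
  have hmain := hasFDerivAt_integral_of_dominated_of_fderiv_le (𝕜 := ℝ) (μ := volume)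
    (F := fun (q : ℝ × ℝ) (t : ℝ) => e t * u (q.1, q.2, t)) (F' := F') (x₀ := q) (s := Set.univ)
    (bound := (Set.Icc (-R) R).indicator fun _ => K * ‖ι‖) Filter.univ_mem
    (Filter.Eventually.of_forall fun z =>
      (hec.mul (hu.contDiff_slice z).continuous).aestronglyMeasurable)
    ((hec.mul (hu.contDiff_slice q).continuous).integrable_of_hasCompactSupport
      (hu.hasCompactSupport_slice q).mul_left)
    hF'c.aestronglyMeasurable
    (Filter.Eventually.of_forall fun t z _ => by
      by_cases ht : t ∈ Set.Icc (-R) R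
      · rw [Set.indicator_of_mem ht, hF', norm_smul, hen, one_mul]
        exact (ContinuousLinearMap.opNorm_comp_le _ _).trans (by gcongr; exact hK _)
      · rw [Set.indicator_of_notMem ht, hF']
        have : R < ‖t‖ := by
          rw [← not_le, Real.norm_eq_abs, abs_le]
          exact ht
        simp [hzero _ (this.trans_le (norm_slice_ge z t).1)])
    ((integrable_indicator_iff measurableSet_Icc).2 (integrableOn_const (by simp)))
    (Filter.Eventually.of_forall fun t z _ => by
      have h1 : HasFDerivAt (fun q : ℝ × ℝ => ((q.1, q.2, t) : R3)) ι z :=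
        hasFDerivAt_fst.prodMk (hasFDerivAt_snd.prodMk (hasFDerivAt_const t z))
      have h2 := ((hu.1.differentiable (by simp)) (z.1, z.2, t)).hasFDerivAt.comp z h1
      exact h2.const_mul (e t))
  refine ⟨∫ t, F' q t, ?_, fun v => ?_⟩
  · have : pFourier τ u = fun q => ∫ t, e t * u (q.1, q.2, t) := funext fun q => pFourier_eq τ u q
    rw [this]
    exact hmain
  · have hi : Integrable (F' q) := by
      refine hF'c.integrable_of_hasCompactSupport ?_
      refine HasCompactSupport.of_support_subset_isCompact (isCompact_closedBall (0 : ℝ) R)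
        fun t ht => ?_
      rw [mem_closedBall_zero_iff]
      by_contra h
      refine ht ?_
      refine ContinuousLinearMap.ext fun z => ?_
      change e t * fderiv ℝ u (q.1, q.2, t) (ι z) = 0
      rw [hzero _ ((not_le.1 h).trans_le (norm_slice_ge q t).1), zero_apply, mul_zero]
    rw [ContinuousLinearMap.integral_apply hi, pFourier_eq]
    rfl

lemma differentiable_pFourier (hu : IsTest u) : Differentiable ℝ (pFourier τ u) := fun q => by
  obtain ⟨D, hD, -⟩ := hasFDerivAt_pFourier (τ := τ) hu q
  exact hD.differentiableAt

lemma fderiv_pFourier (hu : IsTest u) (q v : ℝ × ℝ) : fderiv ℝ (pFourier τ u) q v =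
    pFourier τ (fun p => fderiv ℝ u p (v.1, v.2, 0)) q := by
  obtain ⟨D, hD, h⟩ := hasFDerivAt_pFourier (τ := τ) hu q
  rw [hD.fderiv, h]

lemma pFourier_T (hu : IsTest u) (q : ℝ × ℝ) :
    pFourier τ (T u) q = ((2 * Real.pi * τ : ℝ) : ℂ) * Complex.I * pFourier τ u q := by
  have hd : Differentiable ℝ (fun t => u (q.1, q.2, t)) :=
    (hu.contDiff_slice q).differentiable (by simp)
  have e : (fun t => T u (q.1, q.2, t)) = deriv (fun t => u (q.1, q.2, t)) := by
    funext t
    have h1 : HasDerivAt (fun t : ℝ => ((q.1, q.2, t) : R3)) (0, 0, 1) t :=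
      (hasDerivAt_const t q.1).prodMk ((hasDerivAt_const t q.2).prodMk (hasDerivAt_id t))
    exact ((((hu.1.differentiable (by simp)) _).hasFDerivAt).comp_hasDerivAt t h1).deriv.symm
  have h := Real.fourier_deriv (hu.integrable_slice q) hd (by
    rw [← e]
    exact hu.T.integrable_slice q)
  rw [pFourier, e, h, pFourier]
  push_cast
  simp only [smul_eq_mul]
  ring

/-- Three terms, as in `Lt`; shorter combinations are obtained with a zero coefficient. -/
lemma pFourier_linear_combination (hu : IsTest u) (hv : IsTest v) (hw : IsTest w) (a b c : ℂ)
    (q : ℝ × ℝ) : pFourier τ (fun p => a * u p + b * v p + c * w p) q =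
      a * pFourier τ u q + b * pFourier τ v q + c * pFourier τ w q := by
  simp only [pFourier_eq]
  set e : ℝ → ℂ := fun t => Complex.exp (((-2 * Real.pi * t * τ : ℝ) : ℂ) * Complex.I) with he
  have hec : Continuous e := by fun_prop
  have hi : ∀ {g : R3 → ℂ}, IsTest g → Integrable (fun t => e t * g (q.1, q.2, t)) := fun hg =>
    (hec.mul (hg.contDiff_slice q).continuous).integrable_of_hasCompactSupport
      (hg.hasCompactSupport_slice q).mul_left
  have h1 := (hi hu).const_mul a
  have h2 := (hi hv).const_mul b
  have h3 := (hi hw).const_mul c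
  rw [← integral_const_mul, ← integral_const_mul, ← integral_const_mul, ← integral_add h1 h2]
  refine Eq.trans ?_ (integral_add (h1.add h2) h3)
  refine integral_congr_ae (Filter.Eventually.of_forall fun t => ?_)
  simp only [he]
  ring

lemma pFourier_coord_mul (f : ℝ → ℝ) (q : ℝ × ℝ) :
    pFourier τ (fun p => (f p.1 : ℂ) * u p) q = f q.1 * pFourier τ u q := by
  simp only [pFourier_eq]
  rw [← integral_const_mul]
  refine integral_congr_ae (Filter.Eventually.of_forall fun t => ?_)
  ring

lemma pFourier_X (hu : IsTest u) (q : ℝ × ℝ) :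
    pFourier τ (X u) q = fderiv ℝ (pFourier τ u) q (1, 0) :=
  (fderiv_pFourier hu q (1, 0)).symm

lemma pFourier_Y (hu : IsTest u) (q : ℝ × ℝ) : pFourier τ (Y 1 u) q =
    fderiv ℝ (pFourier τ u) q (0, 1) +
      q.1 * (((2 * Real.pi * τ : ℝ) : ℂ) * Complex.I * pFourier τ u q) := by
  have e : Y 1 u = fun p => 1 * fderiv ℝ u p (0, 1, 0) + 1 * ((p.1 : ℂ) * T u p) + 0 * u p := by
    funext p
    rw [Y_eq]
    simp
  rw [e, pFourier_linear_combination (hu.fderiv_apply _) (hu.T.coord_mul (f := fun x => x) contDiff_id) hu,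
    pFourier_coord_mul (fun x => x), pFourier_T hu, fderiv_pFourier hu]
  simp

/-- Plancherel's theorem for the partial Fourier transform. -/
lemma lintegral_pFourier (hu : IsTest u) :
    ∫⁻ τ : ℝ, ∫⁻ q : ℝ × ℝ, ENNReal.ofReal (‖pFourier τ u q‖ ^ 2) =
      ∫⁻ p : R3, ENNReal.ofReal (‖u p‖ ^ 2) := by
  have h1 : ∀ q : ℝ × ℝ, ∫⁻ τ : ℝ, ENNReal.ofReal (‖pFourier τ u q‖ ^ 2) =
      ∫⁻ t : ℝ, ENNReal.ofReal (‖u (q.1, q.2, t)‖ ^ 2) := by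
    intro q
    set g := (hu.hasCompactSupport_slice q).toSchwartzMap (hu.contDiff_slice q) with hg
    have h := SchwartzMap.integral_norm_sq_fourier g
    have hi : ∀ f : SchwartzMap ℝ ℂ, Integrable (fun t => ‖f t‖ ^ 2) := fun f =>
      (memLp_two_iff_integrable_sq_norm f.continuous.aestronglyMeasurable).1 (f.memLp 2)
    have h' := congrArg ENNReal.ofReal h
    rw [ofReal_integral_eq_lintegral_ofReal (hi _) (Filter.Eventually.of_forall fun _ => by positivity),
      ofReal_integral_eq_lintegral_ofReal (hi _)
        (Filter.Eventually.of_forall fun _ => by positivity)] at h'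
    exact h'
  have hm : Measurable (fun z : ℝ × ℝ × ℝ => ENNReal.ofReal (‖pFourier z.1 u z.2‖ ^ 2)) :=
    (ENNReal.continuous_ofReal.comp ((continuous_pFourier hu).norm.pow 2)).measurable
  have hm2 : Measurable (fun p : R3 => ENNReal.ofReal (‖u p‖ ^ 2)) :=
    (ENNReal.continuous_ofReal.comp (hu.1.continuous.norm.pow 2)).measurable
  -- With lower integrals Tonelli requires only measurability, and the one-dimensional Plancherel
  -- theorem applies on each line parallel to the `t` axis.
  rw [lintegral_lintegral_swap (f := fun τ q => ENNReal.ofReal (‖pFourier τ u q‖ ^ 2))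
    hm.aemeasurable]
  simp_rw [h1]
  rw [Measure.volume_eq_prod ℝ (ℝ × ℝ), lintegral_prod _ hm2.aemeasurable, Measure.volume_eq_prod,
    lintegral_prod]
  · refine lintegral_congr fun x => ?_
    rw [lintegral_prod]
    exact (hm2.comp measurable_prodMk_left).aemeasurable
  · have hm3 : Measurable (fun z : (ℝ × ℝ) × ℝ => ENNReal.ofReal (‖u (z.1.1, z.1.2, z.2)‖ ^ 2)) :=
      hm2.comp (by fun_prop)
    exact hm3.lintegral_prod_right'.aemeasurable

end pFourier

/-- The `L²(ℝ²)` pairing of partial Fourier transforms. -/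
def pair (τ : ℝ) (u v : R3 → ℂ) : ℂ :=
  ∫ q : ℝ × ℝ, pFourier τ u q * (starRingEnd ℂ) (pFourier τ v q)

/-- The squared `L²(ℝ²)` norm of the partial Fourier transform. -/
def pNormSq (τ : ℝ) (u : R3 → ℂ) : ℝ := ∫ q : ℝ × ℝ, ‖pFourier τ u q‖ ^ 2

/-! ### Hermitian form at fixed frequency; skew-adjointness of `X` and `Y`. -/

section pair

variable {u v w z : R3 → ℂ} {τ : ℝ}

lemma memLp_pFourier (hu : IsTest u) : MemLp (pFourier τ u) 2 volume :=
  memLp_of_continuous_of_hasCompactSupport (continuous_pFourier_right hu)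
    (hasCompactSupport_pFourier hu)

lemma integrable_pair (hu : IsTest u) (hv : IsTest v) :
    Integrable (fun q => pFourier τ u q * (starRingEnd ℂ) (pFourier τ v q)) :=
  (memLp_pFourier hu).integrable_mul (memLp_conj (memLp_pFourier hv))

lemma pNormSq_nonneg : 0 ≤ pNormSq τ u := integral_nonneg fun _ => by positivity

lemma pair_self : pair τ u u = pNormSq τ u := by
  rw [pair, pNormSq, ← integral_complex_ofReal]
  refine integral_congr_ae (Filter.Eventually.of_forall fun q => ?_)
  simp only [Complex.mul_conj, Complex.normSq_eq_norm_sq]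

lemma conj_pair : (starRingEnd ℂ) (pair τ u v) = pair τ v u := by
  rw [pair, pair, ← integral_conj]
  refine integral_congr_ae (Filter.Eventually.of_forall fun q => ?_)
  simp [mul_comm]

lemma norm_pair_sq_le (hu : IsTest u) (hv : IsTest v) :
    ‖pair τ u v‖ ^ 2 ≤ pNormSq τ u * pNormSq τ v := by
  simpa only [RCLike.norm_conj, pair, pNormSq] using
    norm_integral_mul_sq_le (memLp_pFourier hu) (memLp_conj (memLp_pFourier (τ := τ) hv))

lemma pair_linear_combination_left (hu : IsTest u) (hv : IsTest v) (hw : IsTest w)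
    (hz : IsTest z) (a b c : ℂ) : pair τ (fun p => a * u p + b * v p + c * w p) z =
      a * pair τ u z + b * pair τ v z + c * pair τ w z := by
  simp only [pair, pFourier_linear_combination hu hv hw]
  have h1 := (integrable_pair (τ := τ) hu hz).const_mul a
  have h2 := (integrable_pair (τ := τ) hv hz).const_mul b
  have h3 := (integrable_pair (τ := τ) hw hz).const_mul c
  rw [← integral_const_mul, ← integral_const_mul, ← integral_const_mul, ← integral_add h1 h2]
  refine Eq.trans ?_ (integral_add (h1.add h2) h3)
  refine integral_congr_ae (Filter.Eventually.of_forall fun t => ?_)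
  ring

lemma pair_coord_mul (f : ℝ → ℝ) :
    pair τ (fun p => (f p.1 : ℂ) * u p) v = pair τ u (fun p => (f p.1 : ℂ) * v p) := by
  simp only [pair, pFourier_coord_mul]
  refine integral_congr_ae (Filter.Eventually.of_forall fun t => ?_)
  simp only [map_mul, Complex.conj_ofReal]
  ring

lemma pair_T_left (hu : IsTest u) : pair τ (T u) v =
    ((2 * Real.pi * τ : ℝ) : ℂ) * Complex.I * pair τ u v := by
  simp only [pair, pFourier_T hu]
  rw [← integral_const_mul]
  refine integral_congr_ae (Filter.Eventually.of_forall fun t => ?_)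
  ring

lemma integral_fderiv_pFourier_mul_conj (hu : IsTest u) (hv : IsTest v) (e : ℝ × ℝ) :
    ∫ q, fderiv ℝ (pFourier τ u) q e * (starRingEnd ℂ) (pFourier τ v q) =
      -∫ q, pFourier τ u q * (starRingEnd ℂ) (fderiv ℝ (pFourier τ v) q e) := by
  have hdv : Differentiable ℝ (fun q => (starRingEnd ℂ) (pFourier τ v q)) :=
    Complex.conjCLE.differentiable.comp (differentiable_pFourier hv)
  have h := integral_mul_fderiv_eq_neg_fderiv_mul_of_integrable (μ := (volume : Measure (ℝ × ℝ)))
    (f := pFourier τ u) (g := fun q => (starRingEnd ℂ) (pFourier τ v q)) (v := e) ?_ ?_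
    (integrable_pair hu hv) (fun q _ => differentiable_pFourier hu q) (fun q _ => hdv q)
  · simp only [fderiv_conj] at h
    rw [h, neg_neg]
  · simp only [fderiv_pFourier hu]
    exact integrable_pair (hu.fderiv_apply _) hv
  · simp only [fderiv_conj, fderiv_pFourier hv]
    exact integrable_pair hu (hv.fderiv_apply _)

lemma pair_X (hu : IsTest u) (hv : IsTest v) : pair τ (X u) v = -pair τ u (X v) := by
  simp only [pair, pFourier_X hu, pFourier_X hv]
  exact integral_fderiv_pFourier_mul_conj hu hv (1, 0)

/-- On the Fourier side `Y` is `∂_y + i (2πτ) x`: integration by parts handles the first summand,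
and the second is multiplication by an imaginary function. -/
lemma pair_Y (hu : IsTest u) (hv : IsTest v) : pair τ (Y 1 u) v = -pair τ u (Y 1 v) := by
  have h := integral_fderiv_pFourier_mul_conj (τ := τ) hu hv (0, 1)
  set θ : ℂ := ((2 * Real.pi * τ : ℝ) : ℂ) * Complex.I with hθ
  have hθc : (starRingEnd ℂ) θ = -θ := by
    rw [hθ, map_mul, Complex.conj_ofReal, Complex.conj_I, mul_neg]
  have hx : Integrable (fun q : ℝ × ℝ => θ * (pFourier τ (fun p => (p.1 : ℂ) * u p) q *
      (starRingEnd ℂ) (pFourier τ v q))) :=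
    (integrable_pair (hu.coord_mul (f := fun x => x) contDiff_id) hv).const_mul θ
  have h1 : Integrable (fun q => fderiv ℝ (pFourier τ u) q (0, 1) *
      (starRingEnd ℂ) (pFourier τ v q)) := by
    simp only [fderiv_pFourier hu]
    exact integrable_pair (hu.fderiv_apply _) hv
  have h2 : Integrable (fun q => pFourier τ u q *
      (starRingEnd ℂ) (fderiv ℝ (pFourier τ v) q (0, 1))) := by
    simp only [fderiv_pFourier hv]
    exact integrable_pair hu (hv.fderiv_apply _)
  have e1 : pair τ (Y 1 u) v = (∫ q, fderiv ℝ (pFourier τ u) q (0, 1) *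
      (starRingEnd ℂ) (pFourier τ v q)) + ∫ q : ℝ × ℝ, θ *
        (pFourier τ (fun p => (p.1 : ℂ) * u p) q * (starRingEnd ℂ) (pFourier τ v q)) := by
    rw [← integral_add h1 hx, pair]
    refine integral_congr_ae (Filter.Eventually.of_forall fun q => ?_)
    simp only [pFourier_Y hu, pFourier_coord_mul (fun x => x), ← hθ]
    ring
  have e2 : pair τ u (Y 1 v) = (∫ q, pFourier τ u q *
      (starRingEnd ℂ) (fderiv ℝ (pFourier τ v) q (0, 1))) - ∫ q : ℝ × ℝ, θ *
        (pFourier τ (fun p => (p.1 : ℂ) * u p) q * (starRingEnd ℂ) (pFourier τ v q)) := by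
    rw [← integral_sub h2 hx, pair]
    refine integral_congr_ae (Filter.Eventually.of_forall fun q => ?_)
    simp only [pFourier_Y hv, pFourier_coord_mul (fun x => x), ← hθ, map_add, map_mul, hθc,
      Complex.conj_ofReal]
    ring
  rw [e1, e2, h]
  ring

lemma pNormSq_coord_mul_le {f : ℝ → ℝ} {c δ : ℝ} (hu : IsTest u)
    (hs : ∀ p : R3, u p ≠ 0 → |p.1| ≤ δ) (hf : ∀ x, |x| ≤ δ → |f x| ≤ c) :
    pNormSq τ (fun p => (f p.1 : ℂ) * u p) ≤ c ^ 2 * pNormSq τ u := by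
  rw [pNormSq, pNormSq, ← integral_const_mul]
  refine integral_mono_of_nonneg (Filter.Eventually.of_forall fun q => by positivity)
    (((memLp_two_iff_integrable_sq_norm (memLp_pFourier hu).1).1 (memLp_pFourier hu)).const_mul _)
    (Filter.Eventually.of_forall fun q => ?_)
  simp only [pFourier_coord_mul, norm_mul, Complex.norm_real, Real.norm_eq_abs, mul_pow]
  by_cases hq : |q.1| ≤ δ
  · gcongr
    exact hf _ hq
  · have : pFourier τ u q = 0 := by
      rw [pFourier_eq]
      have h0 : ∀ t, u (q.1, q.2, t) = 0 := fun t => by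
        by_contra h
        exact hq (hs _ h)
      simp [h0]
    simp [this]

end pair

/-- The coefficient `1 - x ^ 4`. -/
def quartic (x : ℝ) : ℝ := 1 - x ^ 4

/-! ### The a priori estimate for `a = 1 - x ^ 4`. -/

lemma contDiff_quartic : ContDiff ℝ ∞ quartic := contDiff_const.sub (contDiff_id.pow 4)

/-- Here `n`, `n₁`, `n₂` stand for the squared norms of `u`, `x u`, `x² u`, and `Q` for the
quadratic form. For `θ ≥ 0`, or bounded `|θ|`, the Poincaré inequality `n ≤ nX / 4` suffices. For `θ
= -t` with `t > 1`, either `t n ≤ Q`, or `nX ≤ 2 t n`; then the uncertainty inequality gives `n ≤ 8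
t n₁`, Cauchy–Schwarz turns this into `n ≤ 64 t² n₂`, and `t n₂ ≤ Q` concludes. -/
lemma energy_bound {n n₁ n₂ nX nY θ Q : ℝ} (hn : 0 ≤ n) (hn₁ : 0 ≤ n₁) (hn₂ : 0 ≤ n₂)
    (hnX : 0 ≤ nX) (hnY : 0 ≤ nY) (hQ : Q = nX + nY + θ * (n - n₂)) (hcomm : |θ| * n ≤ nX + nY)
    (h1 : n ^ 2 ≤ 4 * n₁ * nX) (h2 : n₁ ^ 2 ≤ n * n₂) (h3 : n₁ ≤ n / 16) (h4 : n₂ ≤ n) :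
    n ≤ 64 * (1 + |θ|) * Q := by
  have hpoinc : n ≤ nX / 4 := by
    rcases hn.eq_or_lt with h0 | h0
    · rw [← h0]; positivity
    · have : n * n ≤ n * (nX / 4) := by nlinarith
      exact le_of_mul_le_mul_left this h0
  rcases le_or_gt 0 θ with hθ | hθ
  · have hQ1 : n ≤ Q := by nlinarith
    rw [abs_of_nonneg hθ]
    nlinarith
  · rw [abs_of_neg hθ] at hcomm ⊢
    obtain ⟨t, rfl⟩ : ∃ t, θ = -t := ⟨-θ, by ring⟩
    have ht : 0 < t := by linarith
    simp only [neg_neg] at hcomm ⊢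
    have hQ0 : 0 ≤ Q := by nlinarith [mul_nonneg ht.le hn₂]
    have hX : nX ≤ Q + t * n := by nlinarith [mul_nonneg ht.le hn₂]
    have h2Q : t * n₂ ≤ Q := by nlinarith
    rcases le_or_gt t 1 with ht1 | ht1
    · have : n ≤ Q := by nlinarith
      nlinarith
    · rcases le_or_gt (t * n) Q with hc | hc
      · have : n ≤ Q := by nlinarith
        nlinarith
      · have hn0 : 0 < n := by
          rcases hn.eq_or_lt with h0 | h0
          · rw [← h0] at hc
            linarith
          · exact h0
        have hX2 : nX ≤ 2 * t * n := by linarith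
        have e1 : n ≤ 8 * t * n₁ := by
          have : n * n ≤ n * (8 * t * n₁) := by nlinarith
          exact le_of_mul_le_mul_left this hn0
        have e2 : n ≤ 64 * t ^ 2 * n₂ := by
          have : n * n ≤ n * (64 * t ^ 2 * n₂) := by
            calc n * n ≤ (8 * t * n₁) * (8 * t * n₁) := by gcongr
              _ = 64 * t ^ 2 * n₁ ^ 2 := by ring
              _ ≤ 64 * t ^ 2 * (n * n₂) := by gcongr
              _ = _ := by ring
          exact le_of_mul_le_mul_left this hn0
        have e3 : 64 * t ^ 2 * n₂ ≤ 64 * t * Q := by nlinarith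
        nlinarith

lemma pNormSq_le (τ : ℝ) {u : R3 → ℂ} (hu : IsTest u)
    (hs : ∀ p : R3, u p ≠ 0 → |p.1| ≤ 1 / 4) :
    pNormSq τ u ≤ 8192 * (pNormSq τ (Lt 1 quartic u) + pNormSq τ (T (Lt 1 quartic u))) := by
  set θ : ℝ := 2 * Real.pi * τ with hθ
  have hd : ∀ {w : R3 → ℂ}, ContDiff ℝ ∞ w → Differentiable ℝ w := fun hw =>
    hw.differentiable (by simp)
  have hL := hu.Lt (k := 1) contDiff_quartic
  have hid : ContDiff ℝ ∞ (fun x : ℝ => x) := contDiff_id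
  have hsq : ContDiff ℝ ∞ (fun x : ℝ => x ^ 2) := contDiff_id.pow 2
  have hxu := hu.coord_mul hid
  have hx2u := hu.coord_mul hsq
  set n := pNormSq τ u
  set n₁ := pNormSq τ (fun p => (p.1 : ℂ) * u p) with hn₁
  set n₂ := pNormSq τ (fun p => ((p.1 ^ 2 : ℝ) : ℂ) * u p) with hn₂
  set nX := pNormSq τ (X u)
  set nY := pNormSq τ (Y 1 u)
  set nL := pNormSq τ (Lt 1 quartic u)
  have hn0 : 0 ≤ n := pNormSq_nonneg
  have hnX0 : 0 ≤ nX := pNormSq_nonneg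
  have hnY0 : 0 ≤ nY := pNormSq_nonneg
  have hnL0 : 0 ≤ nL := pNormSq_nonneg
  -- the commutator identity
  have hcomm : |θ| * n ≤ nX + nY := by
    -- Since `[X, Y] = T` for `k = 1`, this says `2 i Im ⟨Xu, Yu⟩ = i θ n`.
    have c1 : pair τ (X u) (Y 1 u) - pair τ (Y 1 u) (X u) = pair τ (T u) u := by
      have e : T u = fun p => 1 * X (Y 1 u) p + (-1) * Y 1 (X u) p + 0 * u p := by
        funext p
        have := XY_eq (k := 1) hu.1 p
        simp only [XY] at this
        simp only [Nat.cast_one, Nat.sub_self, pow_zero, mul_one, Complex.ofReal_one, one_mul] at this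
        linear_combination -this
      rw [e, pair_linear_combination_left hu.Y.X hu.X.Y hu hu, pair_X hu.Y hu, pair_Y hu.X hu]
      ring
    rw [pair_T_left hu, ← hθ, pair_self, ← conj_pair (u := X u)] at c1
    have c2 := congrArg Complex.im c1
    simp only [Complex.sub_im, Complex.conj_im, Complex.mul_im, Complex.ofReal_re,
      Complex.ofReal_im, Complex.I_re, Complex.I_im, Complex.mul_re] at c2
    have c3 : θ * n = 2 * (pair τ (X u) (Y 1 u)).im := by
      change θ * pNormSq τ u = _
      linear_combination -c2
    have c4 := Complex.abs_im_le_norm (pair τ (X u) (Y 1 u))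
    have c5 := norm_pair_sq_le (τ := τ) hu.X (hu.Y (k := 1))
    have c6 : ‖pair τ (X u) (Y 1 u)‖ ≤ (nX + nY) / 2 := by
      refine abs_le_of_sq_le_sq' (c5.trans ?_) (by positivity) |>.2
      change nX * nY ≤ _
      nlinarith [sq_nonneg (nX - nY)]
    calc |θ| * n = |θ * n| := by rw [abs_mul θ n, abs_of_nonneg hn0]
      _ = 2 * |(pair τ (X u) (Y 1 u)).im| := by rw [c3, abs_mul, abs_two]
      _ ≤ _ := by linarith
  -- Heisenberg's inequality: integrating `X (x u)` by parts gives `n = -2 Re ⟨x u, X u⟩`.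
  have h1 : n ^ 2 ≤ 4 * n₁ * nX := by
    have e : X (fun p => (p.1 : ℂ) * u p) =
        fun p => 1 * u p + 1 * ((p.1 : ℂ) * X u p) + 0 * u p := by
      rw [X_mul (hd contDiff_cx) (hd hu.1)]
      funext p
      have : X (fun p : R3 => (p.1 : ℂ)) p = 1 :=
        fderiv_eq_of_hasDerivAt (hd contDiff_cx) (by simpa using hasDerivAt_line p.1 1)
      rw [this]
      ring
    have c1 := pair_X (τ := τ) hxu hu
    rw [e, pair_linear_combination_left hu (hu.X.coord_mul hid) hu hu,
      pair_coord_mul (fun x => x), ← conj_pair (u := fun p : R3 => (p.1 : ℂ) * u p),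
      pair_self] at c1
    have c2 := congrArg Complex.re c1
    simp at c2
    have c3 := norm_pair_sq_le (τ := τ) hxu hu.X
    have c4 := Complex.abs_re_le_norm (pair τ (fun p => (p.1 : ℂ) * u p) (X u))
    have c5 : n = -2 * (pair τ (fun p => (p.1 : ℂ) * u p) (X u)).re := by
      change pNormSq τ u = _
      linarith
    have c6 : n ≤ 2 * ‖pair τ (fun p => (p.1 : ℂ) * u p) (X u)‖ := by
      have := neg_abs_le (pair τ (fun p => (p.1 : ℂ) * u p) (X u)).re
      linarith
    calc n ^ 2 ≤ (2 * ‖pair τ (fun p => (p.1 : ℂ) * u p) (X u)‖) ^ 2 := by gcongr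
      _ = 4 * ‖pair τ (fun p => (p.1 : ℂ) * u p) (X u)‖ ^ 2 := by ring
      _ ≤ 4 * (n₁ * nX) := by gcongr
      _ = _ := by ring
  have h2 : n₁ ^ 2 ≤ n * n₂ := by
    have c1 : pair τ u (fun p => ((p.1 ^ 2 : ℝ) : ℂ) * u p) = n₁ := by
      rw [hn₁, ← pair_self, pair_coord_mul (fun x => x)]
      congr 1
      funext p
      push_cast
      ring
    have c2 := norm_pair_sq_le (τ := τ) hu hx2u
    rw [c1, Complex.norm_real, Real.norm_eq_abs, sq_abs] at c2
    exact c2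
  have h3 : n₁ ≤ n / 16 := by
    have := pNormSq_coord_mul_le (τ := τ) (f := fun x => x) hu hs (fun x hx => hx)
    change n₁ ≤ (1 / 4) ^ 2 * n at this
    linarith
  have h4 : n₂ ≤ n := by
    have := pNormSq_coord_mul_le (τ := τ) (f := fun x => x ^ 2) (c := 1) hu hs (fun x hx => by
      rw [abs_pow]
      exact pow_le_one₀ (abs_nonneg _) (by linarith))
    change n₂ ≤ 1 ^ 2 * n at this
    linarith
  -- the energy identity
  have hQ : pair τ (Lt 1 quartic u) u = ((nX + nY + θ * (n - n₂) : ℝ) : ℂ) := by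
    have e : Lt 1 quartic u = fun p => (-1) * X (X u) p + (-1) * Y 1 (Y 1 u) p +
        (-Complex.I) * ((quartic p.1 : ℂ) * T u p) := by
      funext p
      simp only [Lt, L, XY_eq hu.1]
      push_cast
      ring
    have eq : (fun p => (quartic p.1 : ℂ) * u p) = fun p => 1 * u p +
        (-1) * (((p.1 ^ 2 : ℝ) : ℂ) * (((p.1 ^ 2 : ℝ) : ℂ) * u p)) + 0 * u p := by
      funext p
      simp only [quartic]
      push_cast
      ring
    have c1 : pair τ (fun p => (quartic p.1 : ℂ) * T u p) u =
        (θ : ℂ) * Complex.I * ((n - n₂ : ℝ) : ℂ) := by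
      rw [pair_coord_mul, pair_T_left hu, ← pair_coord_mul, eq,
        pair_linear_combination_left hu (hx2u.coord_mul hsq) hu hu, pair_coord_mul (fun x => x ^ 2),
        pair_self, pair_self, ← hθ, ← hn₂]
      push_cast
      ring
    rw [e, pair_linear_combination_left hu.X.X hu.Y.Y (hu.T.coord_mul contDiff_quartic) hu,
      pair_X hu.X hu, pair_Y hu.Y hu, c1, pair_self, pair_self]
    push_cast
    linear_combination (-(θ : ℂ) * (n - n₂)) * Complex.I_sq
  set Q : ℝ := nX + nY + θ * (n - n₂) with hQdef
  have hmain := energy_bound hn0 pNormSq_nonneg pNormSq_nonneg hnX0 hnY0 hQdef hcomm h1 h2 h3 h4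
  have hQn : Q ^ 2 ≤ nL * n := by
    have := norm_pair_sq_le (τ := τ) hL hu
    rw [hQ, Complex.norm_real, Real.norm_eq_abs, sq_abs] at this
    exact this
  have hT : pNormSq τ (T (Lt 1 quartic u)) = θ ^ 2 * nL := by
    simp only [nL, pNormSq, pFourier_T hL]
    rw [← integral_const_mul]
    refine integral_congr_ae (Filter.Eventually.of_forall fun q => ?_)
    simp [mul_pow, hθ]
  rw [hT]
  rcases hn0.eq_or_lt with h0 | h0
  · rw [← h0]
    positivity
  -- Combines `n ≤ 64 (1 + |θ|) Q` with `Q² ≤ nL n`. The constant `8192` is `2 * 64 ^ 2`, the `2`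
  -- coming from `(1 + |θ|) ^ 2 ≤ 2 (1 + θ ^ 2)`.
  · have e1 : n * n ≤ n * (64 ^ 2 * (1 + |θ|) ^ 2 * nL) := by
      calc n * n ≤ (64 * (1 + |θ|) * Q) * (64 * (1 + |θ|) * Q) := by
            gcongr
            exact hn0.trans hmain
        _ = 64 ^ 2 * (1 + |θ|) ^ 2 * Q ^ 2 := by ring
        _ ≤ 64 ^ 2 * (1 + |θ|) ^ 2 * (nL * n) := by gcongr
        _ = _ := by ring
    have e2 := le_of_mul_le_mul_left e1 h0
    have e3 : (1 + |θ|) ^ 2 ≤ 2 * (1 + θ ^ 2) := by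
      nlinarith [sq_nonneg (1 - |θ|), sq_abs θ]
    calc n ≤ 64 ^ 2 * (1 + |θ|) ^ 2 * nL := e2
      _ ≤ 64 ^ 2 * (2 * (1 + θ ^ 2)) * nL := by gcongr
      _ = _ := by ring

/-- The a priori estimate for `Lt`, with a loss of derivatives in the direction `∂_t`. -/
theorem integral_norm_sq_le {u : R3 → ℂ} (hu : IsTest u)
    (hs : ∀ p : R3, u p ≠ 0 → |p.1| ≤ 1 / 4) :
    ∫ p, ‖u p‖ ^ 2 ≤ 8192 * ((∫ p, ‖Lt 1 quartic u p‖ ^ 2) +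
      ∫ p, ‖T (Lt 1 quartic u) p‖ ^ 2) := by
  have hL := hu.Lt (k := 1) contDiff_quartic
  have hsq : ∀ {v : R3 → ℂ}, IsTest v → Integrable (fun p => ‖v p‖ ^ 2) := fun hv =>
    (memLp_two_iff_integrable_sq_norm hv.1.continuous.aestronglyMeasurable).1
      (memLp_of_continuous_of_hasCompactSupport hv.1.continuous hv.2)
  have hp : ∀ {v : R3 → ℂ}, IsTest v →
      ENNReal.ofReal (∫ p, ‖v p‖ ^ 2) = ∫⁻ τ : ℝ, ENNReal.ofReal (pNormSq τ v) := by
    intro v hv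
    rw [ofReal_integral_eq_lintegral_ofReal (hsq hv)
      (Filter.Eventually.of_forall fun _ => by positivity), ← lintegral_pFourier hv]
    refine lintegral_congr fun τ => ?_
    rw [pNormSq, ofReal_integral_eq_lintegral_ofReal
      ((memLp_two_iff_integrable_sq_norm (memLp_pFourier hv).1).1 (memLp_pFourier hv))
      (Filter.Eventually.of_forall fun _ => by positivity)]
  have hnn : ∀ v : R3 → ℂ, 0 ≤ ∫ p, ‖v p‖ ^ 2 := fun v => integral_nonneg fun _ => by positivity
  have hm : Measurable (fun τ => ENNReal.ofReal (pNormSq τ (Lt 1 quartic u))) := by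
    have h1 : Continuous (fun z : ℝ × ℝ × ℝ => ‖pFourier z.1 (Lt 1 quartic u) z.2‖ ^ 2) :=
      (continuous_pFourier hL).norm.pow 2
    exact (h1.stronglyMeasurable.integral_prod_right).measurable.ennreal_ofReal
  rw [← ENNReal.ofReal_le_ofReal_iff (mul_nonneg (by norm_num) (add_nonneg (hnn _) (hnn _))), ENNReal.ofReal_mul (by norm_num),
    ENNReal.ofReal_add (hnn _) (hnn _), hp hu, hp hL, hp hL.T, ← lintegral_add_left hm,
    ← lintegral_const_mul' _ _ ENNReal.ofReal_ne_top]
  refine lintegral_mono fun τ => ?_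
  rw [← ENNReal.ofReal_add pNormSq_nonneg pNormSq_nonneg, ← ENNReal.ofReal_mul (by norm_num)]
  exact ENNReal.ofReal_le_ofReal (pNormSq_le τ hu hs)

/-! ### Solvability by duality. -/

lemma exists_dual_comp_eq {E H : Type*} [AddCommGroup E] [Module ℂ E] [NormedAddCommGroup H]
    [NormedSpace ℂ H] (M : E →ₗ[ℂ] H) (l : E →ₗ[ℂ] ℂ) {C : ℝ}
    (h : ∀ x, ‖l x‖ ≤ C * ‖M x‖) : ∃ Λ : H →L[ℂ] ℂ, ∀ x, Λ (M x) = l x := by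
  have hker : LinearMap.ker M ≤ LinearMap.ker l := fun x hx => by
    rw [LinearMap.mem_ker] at hx ⊢
    have := h x
    rw [hx, norm_zero, mul_zero] at this
    exact norm_le_zero_iff.1 this
  -- The estimate makes `l` factor through the range of `M` as a bounded functional, which
  -- Hahn–Banach extends to all of `H`.
  set l' : LinearMap.range M →ₗ[ℂ] ℂ :=
    ((LinearMap.ker M).liftQ l hker).comp M.quotKerEquivRange.symm.toLinearMap with hl'
  have hl'M : ∀ x, l' ⟨M x, LinearMap.mem_range_self M x⟩ = l x := fun x => by
    have : M.quotKerEquivRange.symm ⟨M x, LinearMap.mem_range_self M x⟩ =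
        (LinearMap.ker M).mkQ x := by
      rw [LinearEquiv.symm_apply_eq]
      rfl
    simp [hl', this]
  obtain ⟨Λ, hΛ, -⟩ := exists_extension_norm_eq (LinearMap.range M) (l'.mkContinuous C fun y => by
    obtain ⟨_, x, rfl⟩ := y
    rw [hl'M]
    exact h x)
  exact ⟨Λ, fun x => (hΛ ⟨M x, LinearMap.mem_range_self M x⟩).trans (hl'M x)⟩

section Linearity

variable {u v : R3 → ℂ} {k : ℕ} {a : ℝ → ℝ}

lemma L_add (hu : ContDiff ℝ ∞ u) (hv : ContDiff ℝ ∞ v) (p : R3) :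
    L k a (fun q => u q + v q) p = L k a u p + L k a v p := by
  have hd : ∀ {w : R3 → ℂ}, ContDiff ℝ ∞ w → Differentiable ℝ w := fun hw =>
    hw.differentiable (by simp)
  have cX : ∀ {f : R3 → ℂ}, ContDiff ℝ ∞ f → ContDiff ℝ ∞ (X f) := contDiff_X
  have cY : ∀ {f : R3 → ℂ}, ContDiff ℝ ∞ f → ContDiff ℝ ∞ (Y k f) := contDiff_Y
  simp only [L, XY]
  rw [X_add (hd hu) (hd hv), Y_add (hd hu) (hd hv), X_add (hd (cX hu)) (hd (cX hv)),
    X_add (hd (cY hu)) (hd (cY hv)), Y_add (hd (cX hu)) (hd (cX hv)),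
    Y_add (hd (cY hu)) (hd (cY hv))]
  ring

lemma L_const_mul (c : ℂ) (hu : ContDiff ℝ ∞ u) (p : R3) :
    L k a (fun q => c * u q) p = c * L k a u p := by
  have hc : ContDiff ℝ ∞ (fun _ : R3 => c) := contDiff_const
  have hX : X (fun _ : R3 => c) = fun _ => 0 := by
    funext q
    simp [X]
  have hY : Y k (fun _ : R3 => c) = fun _ => 0 := by
    funext q
    simp [Y]
  rw [L_mul hc hu]
  simp only [L, XY, hX, hY]
  simp [X, Y]

lemma T_add (hu : ContDiff ℝ ∞ u) (hv : ContDiff ℝ ∞ v) (p : R3) :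
    T (fun q => u q + v q) p = T u p + T v p := by
  rw [T, fderiv_fun_add ((hu.differentiable (by simp)) p) ((hv.differentiable (by simp)) p)]
  rfl

lemma T_const_mul (c : ℂ) (hu : ContDiff ℝ ∞ u) (p : R3) :
    T (fun q => c * u q) p = c * T u p := by
  rw [T, fderiv_const_mul ((hu.differentiable (by simp)) p)]
  rfl

end Linearity

lemma isTest_testFunction {V : Opens R3} (ψ : 𝓓(V, ℂ)) : IsTest ψ :=
  ⟨ψ.contDiff, ψ.hasCompactSupport⟩

lemma IsTest.memLp {u : R3 → ℂ} (hu : IsTest u) : MemLp u 2 volume :=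
  memLp_of_continuous_of_hasCompactSupport hu.1.continuous hu.2

/-- The linear map `ψ ↦ (Lt ψ, ∂_t Lt ψ)` into `L² × L²`. -/
def graphLt (k : ℕ) (a : ℝ → ℝ) (ha : ContDiff ℝ ∞ a) (V : Opens R3) :
    𝓓(V, ℂ) →ₗ[ℂ] Lp ℂ 2 (volume : Measure R3) × Lp ℂ 2 (volume : Measure R3) where
  toFun ψ := (((isTest_testFunction ψ).Lt (k := k) ha).memLp.toLp _,
    ((isTest_testFunction ψ).Lt (k := k) ha).T.memLp.toLp _)
  map_add' ψ φ := by
    have e : Lt k a ⇑(ψ + φ) = fun p => Lt k a ψ p + Lt k a φ p :=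
      funext fun p => L_add ψ.contDiff φ.contDiff p
    have hψ := (isTest_testFunction ψ).Lt (k := k) ha
    have hφ := (isTest_testFunction φ).Lt (k := k) ha
    have hψφ := (isTest_testFunction (ψ + φ)).Lt (k := k) ha
    refine Prod.ext ?_ ?_
    · refine Eq.trans ?_ (MemLp.toLp_add hψ.memLp hφ.memLp)
      exact MemLp.toLp_congr hψφ.memLp (hψ.memLp.add hφ.memLp) (Filter.Eventually.of_forall fun p => congrFun e p)
    · refine Eq.trans ?_ (MemLp.toLp_add hψ.T.memLp hφ.T.memLp)
      refine MemLp.toLp_congr hψφ.T.memLp (hψ.T.memLp.add hφ.T.memLp) (Filter.Eventually.of_forall fun p => ?_)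
      rw [e]
      exact T_add (contDiff_L ha.neg ψ.contDiff) (contDiff_L ha.neg φ.contDiff) p
  map_smul' c ψ := by
    have e : Lt k a ⇑(c • ψ) = fun p => c * Lt k a ψ p :=
      funext fun p => L_const_mul c ψ.contDiff p
    have hψ := (isTest_testFunction ψ).Lt (k := k) ha
    have hcψ := (isTest_testFunction (c • ψ)).Lt (k := k) ha
    refine Prod.ext ?_ ?_
    · refine Eq.trans ?_ (MemLp.toLp_const_smul c hψ.memLp)
      exact MemLp.toLp_congr hcψ.memLp (hψ.memLp.const_smul c) (Filter.Eventually.of_forall fun p => congrFun e p)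
    · refine Eq.trans ?_ (MemLp.toLp_const_smul c hψ.T.memLp)
      refine MemLp.toLp_congr hcψ.T.memLp (hψ.T.memLp.const_smul c) (Filter.Eventually.of_forall fun p => ?_)
      rw [e]
      exact T_const_mul c (contDiff_L ha.neg ψ.contDiff) p

/-- A functional on `L²` is the integral against a square integrable function. -/
lemma exists_memLp_repr (l : Lp ℂ 2 (volume : Measure R3) →L[ℂ] ℂ) :
    ∃ g : R3 → ℂ, MemLp g 2 volume ∧
      ∀ (u : R3 → ℂ) (hu : MemLp u 2 volume), l (hu.toLp u) = ∫ p, u p * g p := by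
  set v := (InnerProductSpace.toDual ℂ (Lp ℂ 2 (volume : Measure R3))).symm l with hv
  refine ⟨fun p => (starRingEnd ℂ) (v p), memLp_conj (Lp.memLp v), fun u hu => ?_⟩
  have h := inner_toLp_toLp (Lp.memLp v) hu
  rw [Lp.toLp_coeFn, hv, InnerProductSpace.toDual_symm_apply] at h
  rw [h]
  simp only [mul_comm, hv]

/-- The estimate bounds `ψ ↦ ∫ f ψ` by the norm of `(Lt ψ, ∂_t Lt ψ)`, so it extends to a functional
on `L² × L²`, represented by two square integrable functions. -/
theorem locallySolvable_of_estimate {k : ℕ} {a : ℝ → ℝ} (ha : ContDiff ℝ ∞ a) {V : Opens R3}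
    (h0 : (0 : R3) ∈ V) {C : ℝ} (hC0 : 0 ≤ C)
    (hC : ∀ ψ : 𝓓(V, ℂ), ∫ p, ‖ψ p‖ ^ 2 ≤ C * ((∫ p, ‖Lt k a ψ p‖ ^ 2) +
      ∫ p, ‖T (Lt k a ψ) p‖ ^ 2)) : LocallySolvable k a ha := by
  refine ⟨V, h0, fun f => ?_⟩
  have hmul : ∀ ψ : 𝓓(V, ℂ), Integrable (fun p => f p * ψ p) := fun ψ =>
    (isTest_testFunction f).memLp.integrable_mul (isTest_testFunction ψ).memLp
  let l : 𝓓(V, ℂ) →ₗ[ℂ] ℂ :=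
    { toFun := fun ψ => ∫ p, f p * ψ p
      map_add' := fun ψ φ => by
        rw [← integral_add (hmul ψ) (hmul φ)]
        refine integral_congr_ae (Filter.Eventually.of_forall fun p => ?_)
        exact mul_add _ _ _
      map_smul' := fun c ψ => by
        rw [RingHom.id_apply, smul_eq_mul, ← integral_const_mul]
        refine integral_congr_ae (Filter.Eventually.of_forall fun p => ?_)
        exact mul_left_comm _ _ _ }
  set A : ℝ := ∫ p, ‖f p‖ ^ 2
  have hA : 0 ≤ A := integral_nonneg fun _ => by positivity
  obtain ⟨Λ, hΛ⟩ := exists_dual_comp_eq (graphLt k a ha V) l (C := √(A * (2 * C))) fun ψ => by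
    set N := ‖graphLt k a ha V ψ‖
    have hψL := (isTest_testFunction ψ).Lt (k := k) ha
    have h1 : ∫ p, ‖Lt k a ψ p‖ ^ 2 ≤ N ^ 2 := by
      rw [← norm_toLp_sq hψL.memLp]
      exact pow_le_pow_left₀ (norm_nonneg _) (norm_fst_le (graphLt k a ha V ψ)) 2
    have h2 : ∫ p, ‖T (Lt k a ψ) p‖ ^ 2 ≤ N ^ 2 := by
      rw [← norm_toLp_sq hψL.T.memLp]
      exact pow_le_pow_left₀ (norm_nonneg _) (norm_snd_le (graphLt k a ha V ψ)) 2
    have h3 := norm_integral_mul_sq_le (isTest_testFunction f).memLp (isTest_testFunction ψ).memLp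
    change ‖l ψ‖ ^ 2 ≤ A * _ at h3
    have h4 : ‖l ψ‖ ^ 2 ≤ A * (2 * C) * N ^ 2 := by
      calc ‖l ψ‖ ^ 2 ≤ A * (C * (N ^ 2 + N ^ 2)) := by
            refine h3.trans (mul_le_mul_of_nonneg_left ((hC ψ).trans ?_) hA)
            gcongr
        _ = _ := by ring
    refine abs_le_of_sq_le_sq' ?_ (by positivity) |>.2
    rw [mul_pow, Real.sq_sqrt (by positivity)]
    exact h4
  obtain ⟨g₁, hg₁, hΛ₁⟩ := exists_memLp_repr (Λ.comp (ContinuousLinearMap.inl ℂ _ _))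
  obtain ⟨g₂, hg₂, hΛ₂⟩ := exists_memLp_repr (Λ.comp (ContinuousLinearMap.inr ℂ _ _))
  have hl₁ : LocallyIntegrableOn g₁ V volume :=
    (hg₁.locallyIntegrable (by norm_num)).locallyIntegrableOn _
  have hl₂ : LocallyIntegrableOn g₂ V volume :=
    (hg₂.locallyIntegrable (by norm_num)).locallyIntegrableOn _
  let u₁ : 𝓓(V, ℂ) →L[ℂ] ℂ :=
    TestFunction.integralAgainstBilinCLM (ContinuousLinearMap.mul ℂ ℂ) volume g₁
  let u₂ : 𝓓(V, ℂ) →L[ℂ] ℂ :=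
    TestFunction.integralAgainstBilinCLM (ContinuousLinearMap.mul ℂ ℂ) volume g₂
  let D : 𝓓(V, ℂ) →L[ℂ] 𝓓(V, ℂ) := TestFunction.lineDerivCLM ℂ ((0, 0, 1) : R3)
  -- The solution is the distribution `g₁ - ∂_t g₂`; it need not be square integrable, which is
  -- consistent with part (1).
  refine ⟨u₁ + u₂.comp D, fun ψ => ?_⟩
  have hψL := (isTest_testFunction ψ).Lt (k := k) ha
  have e₁ : u₁ (LtTest k a ha ψ) = ∫ p, Lt k a ψ p * g₁ p :=
    TestFunction.integralAgainstBilinCLM_eq_integral hl₁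
  have e₂ : u₂ (D (LtTest k a ha ψ)) = ∫ p, T (Lt k a ψ) p * g₂ p := by
    refine (TestFunction.integralAgainstBilinCLM_eq_integral hl₂).trans ?_
    refine integral_congr_ae (Filter.Eventually.of_forall fun p => ?_)
    have : D (LtTest k a ha ψ) p = T (Lt k a ψ) p := by
      refine (TestFunction.lineDerivCLM_apply_of_le (by simp)).trans ?_
      exact ((hψL.1.differentiable (by simp)) p).lineDeriv_eq_fderiv
    simp [this]
  change u₁ (LtTest k a ha ψ) + u₂ (D (LtTest k a ha ψ)) = l ψ
  rw [e₁, e₂, ← hΛ₁ _ hψL.memLp, ← hΛ₂ _ hψL.T.memLp, ← hΛ]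
  simp only [ContinuousLinearMap.comp_apply, ContinuousLinearMap.inl_apply,
    ContinuousLinearMap.inr_apply, ← map_add]
  congr 1
  simp [graphLt]

theorem locallySolvable_quartic : LocallySolvable 1 quartic contDiff_quartic := by
  -- A slab suffices: the estimate restricts the support only in `x`.
  let V : Opens R3 := ⟨{p | |p.1| < 1 / 4}, isOpen_lt (by fun_prop) continuous_const⟩
  refine locallySolvable_of_estimate (V := V) (C := 8192) contDiff_quartic
    (by change |(0 : ℝ)| < 1 / 4; norm_num) (by norm_num) fun ψ => ?_
  refine integral_norm_sq_le (isTest_testFunction ψ) fun p hp => ?_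
  have : p ∈ V := ψ.tsupport_subset (subset_tsupport _ hp)
  exact le_of_lt this

lemma iteratedDeriv_quartic : iteratedDeriv 1 quartic 0 = 0 ∧ iteratedDeriv 2 quartic 0 = 0 := by
  have h1 : deriv quartic = fun x => -(4 * x ^ 3) := by
    funext x
    have : HasDerivAt quartic (-(4 * x ^ 3)) x :=
      HasDerivAt.congr_deriv ((hasDerivAt_pow 4 x).const_sub 1) (by norm_num)
    exact this.deriv
  refine ⟨by simp [h1], ?_⟩
  have h2 : HasDerivAt (fun x : ℝ => -(4 * x ^ 3)) (-(4 * (3 * (0 : ℝ) ^ 2))) 0 :=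
    HasDerivAt.congr_deriv ((hasDerivAt_pow 3 (0 : ℝ)).const_mul 4).neg (by norm_num)
  rw [iteratedDeriv_succ, iteratedDeriv_one, h1, h2.deriv]
  simp

end DoubleChar

end

theorem mainTheorem10 :
    (∀ (k : ℕ) (a : ℝ → ℝ), ContDiff ℝ ∞ a →
      ((k = 1 ∧ ∃ m : ℤ, Odd m ∧ a 0 = m) ∨ (1 < k ∧ Odd k ∧ (a 0 = 1 ∨ a 0 = -1))) →
      iteratedDeriv 1 a 0 = 0 → iteratedDeriv 2 a 0 = 0 →
      ¬ DoubleChar.LocallySolvableL2 k a) ∧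
    (∃ (k : ℕ) (a : ℝ → ℝ) (ha : ContDiff ℝ ∞ a), 1 ≤ k ∧
      DoubleChar.LocallySolvable k a ha ∧ ¬ DoubleChar.LocallySolvableL2 k a) := by
  refine ⟨fun k a ha h h1 h2 => DoubleChar.not_locallySolvableL2 ha h h1 h2,
    1, DoubleChar.quartic, DoubleChar.contDiff_quartic, le_rfl,
    DoubleChar.locallySolvable_quartic, ?_⟩
  exact DoubleChar.not_locallySolvableL2 DoubleChar.contDiff_quartic
    (Or.inl ⟨rfl, 1, odd_one, by simp [DoubleChar.quartic]⟩)
    DoubleChar.iteratedDeriv_quartic.1 DoubleChar.iteratedDeriv_quartic.2
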